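/- Let $c_0,\dots,c_{n-1}$ be real numbers with $c_k\ge 0$ for $0\le k\le n-2$ and $\sum_{k=0}^{n-2}c_k>0$ (so $n\ge 2$; $c_{n-1}\in\mathbb R$ is arbitrary), and let $$f(\lambda)=\lambda_1\cdots\lambda_n+c_{n-1}\sigma_{n-1}(\lambda)-\sum_{k=0}^{n-2}c_k\sigma_k(\lambda),\qquad \lambda\in\mathbb R^n,$$ where $\sigma_k$ is the $k$-th elementary symmetric polynomial ($\sigma_0=1$). Let $\Gamma_n=\{\lambda:\lambda_i>0\ \forall i\}$ be the positive orthant. Then the level set $\{f=0\}$, understood as its connected component contained in a translate $q+\Gamma_n$, is convex. Precisely: (1) The polynomial $r_f(x)=f(x,\dots,x)$ is strictly right-Noetherian, that is, for each $k\in\{0,\dots,n-1\}$ the derivative $r_f^{(k)}$ has a real root greater than or equal to all real roots of $r_f^{(k+1)}$, and the largest real root $x_0$ of $r_f$ is strictly greater than all real roots of $r_f'$. Moreover $x_0>0$. (2) There is exactly one connected component $\Gamma$ of $\{f>0\}$ with $\Gamma\subseteq q+\Gamma_n$ for some $q\in\mathbb R^n$. It is strictly $\Upsilon$-stable: $\partial\Gamma\subseteq\Upsilon_1$,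 where $\Upsilon_1$ is the set of $\mu\in\mathbb R^n$ such that for every permutation $s$ of $\{1,\dots,n\}$ the point $(\mu_{s(1)},\dots,\mu_{s(n-1)})$ lies in the projection of $\Gamma$ to the first $n-1$ coordinates. (3) The boundary $\partial\Gamma$ is a connected component of $\{f=0\}$, and it is the only one that is contained in $q+\Gamma_n$ for some $q\in\mathbb R^n$. (4) This level set $\partial\Gamma$ is a convex hypersurface: the region $\Gamma$ that it bounds is convex. -/

import Mathlib

noncomputable section

/-- The multilinear polynomial `λ₁⋯λₙ + c_{n-1} σ_{n-1}(λ) - ∑_{k=0}^{n-2} c_k σ_k(λ)`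
(for `n ≥ 1`), where `σ_k` is the `k`-th elementary symmetric polynomial. -/
def guanZhangPoly (n : ℕ) (c : ℕ → ℝ) : MvPolynomial (Fin n) ℝ :=
  (∏ i, MvPolynomial.X i) + MvPolynomial.C (c (n - 1)) * MvPolynomial.esymm (Fin n) ℝ (n - 1)
    - ∑ k ∈ Finset.range (n - 1), MvPolynomial.C (c k) * MvPolynomial.esymm (Fin n) ℝ k

/-- The set `{f = 0}`. -/
def zeroSet {n : ℕ} (f : MvPolynomial (Fin n) ℝ) : Set (Fin n → ℝ) :=
  {x | MvPolynomial.eval x f = 0}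

/-- The set `{f > 0}`. -/
def positiveSet {n : ℕ} (f : MvPolynomial (Fin n) ℝ) : Set (Fin n → ℝ) :=
  {x | 0 < MvPolynomial.eval x f}

/-- `C` is a connected component of the subset `S` (in particular, `C` is nonempty). -/
def IsComponentOf {n : ℕ} (C S : Set (Fin n → ℝ)) : Prop :=
  ∃ x ∈ S, C = connectedComponentIn S x

/-- `C ⊆ q + Γₙ` for some `q`, where `Γₙ` is the open positive orthant. -/
def InOrthantTranslate {n : ℕ} (C : Set (Fin n → ℝ)) : Prop :=
  ∃ q : Fin n → ℝ, ∀ x ∈ C, ∀ i, q i < x i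

/-- The cone `Υ₁` of `Γ`: the points `μ` such that for every permutation `s`, the tuple
`(μ_{s(1)}, …, μ_{s(n-1)})` lies in the projection of `Γ` that drops the last entry. -/
def upsilonOne {n : ℕ} (Γ : Set (Fin n → ℝ)) : Set (Fin n → ℝ) :=
  {μ | ∀ s : Equiv.Perm (Fin n), ∃ x ∈ Γ, ∀ i : Fin n, (i : ℕ) + 1 < n → x i = μ (s i)}

/-- `Γ` is an `Υ`-stable connected component of `{f > 0}`. -/
def IsUpsilonStable {n : ℕ} (f : MvPolynomial (Fin n) ℝ) (Γ : Set (Fin n → ℝ)) : Prop :=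
  IsComponentOf Γ (positiveSet f) ∧ InOrthantTranslate Γ

/-- `Γ` is a strictly `Υ`-stable connected component of `{f > 0}`. -/
def IsStrictlyUpsilonStable {n : ℕ} (f : MvPolynomial (Fin n) ℝ) (Γ : Set (Fin n → ℝ)) : Prop :=
  IsUpsilonStable f Γ ∧ frontier Γ ⊆ upsilonOne Γ

/-- The diagonal restriction `r_f(x) = f(x, …, x)`. -/
def diagonalRestriction {n : ℕ} (f : MvPolynomial (Fin n) ℝ) : Polynomial ℝ :=
  MvPolynomial.aeval (fun _ => (Polynomial.X : Polynomial ℝ)) f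

/-- For each `k < deg p`, the `k`-th derivative of `p` has a real root that is at least every
real root of the `(k+1)`-st derivative. -/
def IsRightNoetherian (p : Polynomial ℝ) : Prop :=
  ∀ k < p.natDegree, ∃ x, (Polynomial.derivative^[k] p).IsRoot x ∧
    ∀ y, (Polynomial.derivative^[k + 1] p).IsRoot y → y ≤ x

/-- Right-Noetherian, and the largest real root of `p` exceeds every real root of `p'`. -/
def IsStrictlyRightNoetherian (p : Polynomial ℝ) : Prop :=
  IsRightNoetherian p ∧
    ∃ x, p.IsRoot x ∧ ∀ y, (Polynomial.derivative p).IsRoot y → y < x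

end

/-!
For a finite set `T` of variables let `e_T` be the elementary symmetric polynomial of degree
`#T - 1` in these variables. As `(n - k) σ_k` is the sum of the `e_T` with `#T = k + 1`, we can
write `f = σ_n + c_{n-1} σ_{n-1} - ∑ a_T e_T` with weights `a_T ≥ 0`. On the cone where all `e_T`
are positive, `e_{T ∪ {i}} = e_T (x_i + p_T)`, where `p_T` is the parallel sum of the variables in
`T`, which is concave and increasing. Hence `e_V / e_U` is log-concave and increasing for `U ⊆ V`,
its inverse is convex and decreasing, and `f / σ_{n-1} = p + c_{n-1} - ∑ a_T e_T / σ_{n-1}` is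
concave and increasing on the cone. The part `Γ` of `{f > 0}` in the cone is therefore a convex
upper set, and an estimate of the `e_T` from below shows that its closure stays in the cone. So `Γ`
and `∂Γ` are components of `{f > 0}` and `{f = 0}`.

Uniqueness only uses that `f` is affine in each variable. A component of `{f > 0}` that is bounded
below is closed under increasing a variable, since it would otherwise contain a half-line in the
decreasing direction; hence it meets `Γ`. A component of `{f = 0}` that is bounded below contains
arcs of hyperbolas in the coordinate planes, along which one variable increases to infinity while
another one decreases; hence `f > 0` on the open orthant above each of its points, and this orthant
lies in `Γ`.
-/

/-! ### Real polynomials with nonpositive lower coefficients -/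

section Polynomials

open Polynomial Filter Topology

theorem exists_isGreatest_zero_of_tendsto_atTop {f : ℝ → ℝ} (hf : Continuous f)
    (hlim : Tendsto f atTop atTop) {a : ℝ} (ha : f a ≤ 0) :
    ∃ x, IsGreatest {x | f x = 0} x ∧ a ≤ x ∧ ∀ y, x < y → 0 < f y := by
  have exists_zero_ge : ∀ b, f b ≤ 0 → ∃ z, b ≤ z ∧ f z = 0 := fun b hb => by
    obtain ⟨d, hd, hbd⟩ := ((hlim.eventually_ge_atTop 0).and (eventually_ge_atTop b)).exists
    obtain ⟨z, hz, hfz⟩ := intermediate_value_Icc hbd hf.continuousOn ⟨hb, hd⟩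
    exact ⟨z, hz.1, hfz⟩
  obtain ⟨M, hM⟩ := eventually_atTop.1 (hlim.eventually_gt_atTop 0)
  have zeros_bddAbove : BddAbove {x | f x = 0} :=
    ⟨M, fun x hx => le_of_not_ge fun hMx => (hM x hMx).ne' hx⟩
  obtain ⟨z, haz, hz⟩ := exists_zero_ge a ha
  have hgreatest := (isClosed_singleton.preimage hf).isGreatest_csSup ⟨z, hz⟩ zeros_bddAbove
  refine ⟨_, hgreatest, haz.trans (hgreatest.2 hz), fun y hy => ?_⟩
  by_contra! hle
  obtain ⟨w, hyw, hw⟩ := exists_zero_ge y hle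
  exact (hgreatest.2 hw).not_gt (hy.trans_le hyw)

theorem exists_pos_eval_neg_of_trailingCoeff_neg {p : ℝ[X]} (h : p.trailingCoeff < 0) :
    ∃ x, 0 < x ∧ p.eval x < 0 := by
  obtain ⟨q, hq⟩ : X ^ p.natTrailingDegree ∣ p :=
    X_pow_dvd_iff.2 fun _ hd => coeff_eq_zero_of_lt_natTrailingDegree hd
  have hq0 : q.eval 0 < 0 := by
    rwa [trailingCoeff, hq, coeff_X_pow_mul', ← hq, if_pos le_rfl, tsub_self,
      coeff_zero_eq_eval_zero] at h
  obtain ⟨x, hqx, hx⟩ := (((q.continuous.tendsto 0).mono_left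
    (nhdsWithin_le_nhds (s := Set.Ioi 0))).eventually_lt_const hq0).and self_mem_nhdsWithin
    |>.exists
  refine ⟨x, hx, ?_⟩
  rw [hq, eval_mul, eval_X_pow]
  exact mul_neg_of_pos_of_neg (pow_pos hx _) hqx

theorem mul_eval_derivative_eq_sum_range (p : ℝ[X]) (x : ℝ) :
    x * p.derivative.eval x = ∑ i ∈ Finset.range (p.natDegree + 1), i * (p.coeff i * x ^ i) := by
  rw [derivative_eval, p.sum_over_range (by simp), Finset.mul_sum]
  refine Finset.sum_congr rfl fun i _ => ?_
  cases i with
  | zero => simp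
  | succ i => rw [Nat.add_sub_cancel]; ring

theorem natDegree_iterate_derivative_eq (p : ℝ[X]) (k : ℕ) :
    (Polynomial.derivative^[k] p).natDegree = p.natDegree - k := by
  induction k with
  | zero => rfl
  | succ k ih => rw [Function.iterate_succ_apply', natDegree_derivative, ih, Nat.sub_sub]

/-- A real polynomial whose leading coefficient is positive and whose coefficients are nonpositive
except for the two leading ones. The subleading coefficient is unrestricted. -/
structure HasNonposLowerCoeffs (p : ℝ[X]) : Prop where
  leadingCoeff_pos : 0 < p.leadingCoeff
  coeff_nonpos : ∀ j, j + 2 ≤ p.natDegree → p.coeff j ≤ 0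

namespace HasNonposLowerCoeffs

variable {p : ℝ[X]}

theorem derivative (h : HasNonposLowerCoeffs p) (hdeg : p.natDegree ≠ 0) :
    HasNonposLowerCoeffs p.derivative where
  leadingCoeff_pos := by
    rw [leadingCoeff_derivative]
    exact mul_pos h.leadingCoeff_pos (by exact_mod_cast hdeg.bot_lt)
  coeff_nonpos j hj := by
    rw [natDegree_derivative] at hj
    rw [coeff_derivative]
    exact mul_nonpos_of_nonpos_of_nonneg (h.coeff_nonpos _ (by lia)) (by positivity)

theorem iterate_derivative (h : HasNonposLowerCoeffs p) :
    ∀ {k : ℕ}, k ≤ p.natDegree → HasNonposLowerCoeffs (Polynomial.derivative^[k] p)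
  | 0, _ => h
  | k + 1, hk => by
    rw [Function.iterate_succ_apply']
    refine (h.iterate_derivative (k.le_succ.trans hk)).derivative ?_
    rw [natDegree_iterate_derivative_eq]
    lia

theorem mul_eval_lt_mul_eval_derivative (h : HasNonposLowerCoeffs p) {x : ℝ} (hx : 0 < x) :
    (p.natDegree - 1) * p.eval x < x * p.derivative.eval x := by
  rw [mul_eval_derivative_eq_sum_range, eval_eq_sum_range, Finset.mul_sum]
  have leading_lt : (p.natDegree - 1) * (p.coeff p.natDegree * x ^ p.natDegree) <
      p.natDegree * (p.coeff p.natDegree * x ^ p.natDegree) :=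
    mul_lt_mul_of_pos_right (sub_one_lt _) (mul_pos h.leadingCoeff_pos (pow_pos hx _))
  refine Finset.sum_lt_sum (fun i hi => ?_) ⟨_, Finset.self_mem_range_succ _, leading_lt⟩
  obtain hlow | hsub | rfl : i + 2 ≤ p.natDegree ∨ i + 1 = p.natDegree ∨ i = p.natDegree := by
    have := Finset.mem_range_succ_iff.1 hi
    lia
  · refine mul_le_mul_of_nonpos_right ?_
      (mul_nonpos_of_nonpos_of_nonneg (h.coeff_nonpos i hlow) (pow_nonneg hx.le i))
    rw [le_sub_iff_add_le]
    exact_mod_cast (Nat.le_succ _).trans hlow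
  · simp [← hsub]
  · exact leading_lt.le

theorem eval_derivative_pos (h : HasNonposLowerCoeffs p) (hdeg : p.natDegree ≠ 0) {x : ℝ}
    (hx : 0 < x) (hpx : 0 ≤ p.eval x) : 0 < p.derivative.eval x := by
  have hdeg_sub : (0 : ℝ) ≤ p.natDegree - 1 :=
    sub_nonneg.2 (by exact_mod_cast Nat.one_le_iff_ne_zero.2 hdeg)
  exact pos_of_mul_pos_right
    ((mul_nonneg hdeg_sub hpx).trans_lt (h.mul_eval_lt_mul_eval_derivative hx)) hx.le

theorem tendsto_atTop (h : HasNonposLowerCoeffs p) (hdeg : p.natDegree ≠ 0) :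
    Tendsto (fun x => p.eval x) atTop atTop :=
  p.tendsto_atTop_of_leadingCoeff_nonneg (natDegree_pos_iff_degree_pos.1 hdeg.bot_lt)
    h.leadingCoeff_pos.le

theorem exists_root_ge_roots_derivative (h : HasNonposLowerCoeffs p) (hdeg : p.natDegree ≠ 0) :
    ∃ x, p.IsRoot x ∧ ∀ y, p.derivative.IsRoot y → y ≤ x := by
  obtain hdeg_one | hdeg_two : p.natDegree = 1 ∨ 2 ≤ p.natDegree := by lia
  · obtain ⟨x, hx⟩ := exists_root_of_degree_eq_one
      ((degree_eq_iff_natDegree_eq_of_pos one_pos).2 hdeg_one)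
    refine ⟨x, hx, fun y hy => absurd hy ?_⟩
    have hconst : p.derivative.natDegree = 0 := by rw [natDegree_derivative, hdeg_one]
    rw [eq_C_of_natDegree_eq_zero hconst]
    refine not_isRoot_C _ _ ?_
    rw [← hconst]
    exact (h.derivative hdeg).leadingCoeff_pos.ne'
  · have hzero : p.eval 0 ≤ 0 := by
      rw [← coeff_zero_eq_eval_zero]
      exact h.coeff_nonpos 0 hdeg_two
    obtain ⟨x, hx, hx0, hpos⟩ :=
      exists_isGreatest_zero_of_tendsto_atTop p.continuous (h.tendsto_atTop hdeg) hzero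
    refine ⟨x, hx.1, fun y hy => le_of_not_gt fun hxy => ?_⟩
    exact (h.eval_derivative_pos hdeg (hx0.trans_lt hxy) (hpos y hxy).le).ne' hy

theorem isRightNoetherian (h : HasNonposLowerCoeffs p) : IsRightNoetherian p := fun k hk => by
  rw [Function.iterate_succ_apply']
  refine (h.iterate_derivative hk.le).exists_root_ge_roots_derivative ?_
  rw [natDegree_iterate_derivative_eq]
  lia

theorem exists_isGreatest_root_pos (h : HasNonposLowerCoeffs p) (hdeg : p.natDegree ≠ 0)
    (hneg : p.trailingCoeff < 0) :
    ∃ x, IsGreatest {x | p.IsRoot x} x ∧ 0 < x ∧ ∀ y, x < y → 0 < p.eval y := by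
  obtain ⟨a, ha, hpa⟩ := exists_pos_eval_neg_of_trailingCoeff_neg hneg
  obtain ⟨x, hx, hax, hpos⟩ :=
    exists_isGreatest_zero_of_tendsto_atTop p.continuous (h.tendsto_atTop hdeg) hpa.le
  exact ⟨x, hx, ha.trans_le hax, hpos⟩

theorem trailingCoeff_neg (h : HasNonposLowerCoeffs p) {j : ℕ} (hj : j + 2 ≤ p.natDegree)
    (hneg : p.coeff j < 0) : p.trailingCoeff < 0 := by
  have hle : p.natTrailingDegree ≤ j := natTrailingDegree_le_of_ne_zero hneg.ne
  refine lt_of_le_of_ne (h.coeff_nonpos _ (by lia)) (trailingCoeff_nonzero_iff_nonzero.2 ?_)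
  rintro rfl
  exact hneg.ne (coeff_zero j)

theorem isStrictlyRightNoetherian (h : HasNonposLowerCoeffs p) (hdeg : p.natDegree ≠ 0)
    (hneg : p.trailingCoeff < 0) : IsStrictlyRightNoetherian p := by
  obtain ⟨x, hx, hx0, hpos⟩ := h.exists_isGreatest_root_pos hdeg hneg
  have hpos' : ∀ y, x ≤ y → 0 ≤ p.eval y := fun y hxy => by
    obtain rfl | hlt := hxy.eq_or_lt
    exacts [(hx.1 : p.eval x = 0).ge, (hpos y hlt).le]
  refine ⟨h.isRightNoetherian, x, hx.1, fun y hy => lt_of_not_ge fun hxy => ?_⟩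
  exact (h.eval_derivative_pos hdeg (hx0.trans_le hxy) (hpos' y hxy)).ne' hy

end HasNonposLowerCoeffs

theorem eval_diagonalRestriction {n : ℕ} (f : MvPolynomial (Fin n) ℝ) (t : ℝ) :
    (diagonalRestriction f).eval t = MvPolynomial.eval (fun _ => t) f := by
  rw [diagonalRestriction, ← coe_aeval_eq_eval, MvPolynomial.comp_aeval_apply]
  simp only [aeval_X, MvPolynomial.aeval_eq_eval]

theorem aeval_X_esymm (n k : ℕ) :
    MvPolynomial.aeval (fun _ => (X : ℝ[X])) (MvPolynomial.esymm (Fin n) ℝ k) =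
      C (n.choose k : ℝ) * X ^ k := by
  rw [MvPolynomial.esymm, map_sum, Finset.sum_congr rfl (g := fun _ => (X : ℝ[X]) ^ k)]
  · simp
  · intro t ht
    simp [(Finset.mem_powersetCard.1 ht).2]

theorem diagonalRestriction_guanZhangPoly (n : ℕ) (c : ℕ → ℝ) :
    diagonalRestriction (guanZhangPoly n c) = X ^ n + C (c (n - 1) * n.choose (n - 1)) * X ^ (n - 1)
      - ∑ k ∈ Finset.range (n - 1), C (c k * n.choose k) * X ^ k := by
  simp [diagonalRestriction, guanZhangPoly, aeval_X_esymm, mul_assoc]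

theorem coeff_diagonalRestriction_guanZhangPoly (n : ℕ) (c : ℕ → ℝ) (j : ℕ) :
    (diagonalRestriction (guanZhangPoly n c)).coeff j =
      (if j = n then 1 else 0) + (if j = n - 1 then c (n - 1) * n.choose (n - 1) else 0)
        - (if j < n - 1 then c j * n.choose j else 0) := by
  simp only [diagonalRestriction_guanZhangPoly, coeff_sub, coeff_add, finsetSum_coeff, coeff_X_pow,
    coeff_C_mul, mul_ite, mul_one, mul_zero, Finset.sum_ite_eq, Finset.mem_range]

theorem coeff_diagonalRestriction_guanZhangPoly_of_lt {n : ℕ} (c : ℕ → ℝ) {j : ℕ}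
    (hj : j < n - 1) :
    (diagonalRestriction (guanZhangPoly n c)).coeff j = -(c j * n.choose j) := by
  rw [coeff_diagonalRestriction_guanZhangPoly, if_neg (by lia), if_neg (by lia), if_pos hj]
  ring

theorem coeff_self_diagonalRestriction_guanZhangPoly {n : ℕ} (hn : n ≠ 0) (c : ℕ → ℝ) :
    (diagonalRestriction (guanZhangPoly n c)).coeff n = 1 := by
  rw [coeff_diagonalRestriction_guanZhangPoly, if_pos rfl, if_neg (by lia), if_neg (by lia)]
  ring

theorem natDegree_diagonalRestriction_guanZhangPoly {n : ℕ} (hn : n ≠ 0) (c : ℕ → ℝ) :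
    (diagonalRestriction (guanZhangPoly n c)).natDegree = n := by
  refine natDegree_eq_of_le_of_coeff_ne_zero (natDegree_le_iff_coeff_eq_zero.2 fun j hj => ?_) ?_
  · rw [coeff_diagonalRestriction_guanZhangPoly, if_neg hj.ne', if_neg (by lia), if_neg (by lia)]
    ring
  · rw [coeff_self_diagonalRestriction_guanZhangPoly hn]
    exact one_ne_zero

theorem hasNonposLowerCoeffs_diagonalRestriction_guanZhangPoly {n : ℕ} (hn : n ≠ 0) {c : ℕ → ℝ}
    (hc : ∀ k ∈ Finset.range (n - 1), 0 ≤ c k) :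
    HasNonposLowerCoeffs (diagonalRestriction (guanZhangPoly n c)) where
  leadingCoeff_pos := by
    rw [leadingCoeff, natDegree_diagonalRestriction_guanZhangPoly hn,
      coeff_self_diagonalRestriction_guanZhangPoly hn]
    exact one_pos
  coeff_nonpos j hj := by
    rw [natDegree_diagonalRestriction_guanZhangPoly hn] at hj
    rw [coeff_diagonalRestriction_guanZhangPoly_of_lt c (by lia), neg_nonpos]
    exact mul_nonneg (hc j (Finset.mem_range.2 (by lia))) (Nat.cast_nonneg _)

theorem trailingCoeff_diagonalRestriction_guanZhangPoly_neg {n : ℕ} {c : ℕ → ℝ}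
    (hc : ∀ k ∈ Finset.range (n - 1), 0 ≤ c k) (hsum : 0 < ∑ k ∈ Finset.range (n - 1), c k) :
    (diagonalRestriction (guanZhangPoly n c)).trailingCoeff < 0 := by
  obtain ⟨k, hk, hck⟩ := Finset.exists_lt_of_sum_lt (f := fun _ => (0 : ℝ)) (by simpa using hsum)
  rw [Finset.mem_range] at hk
  refine (hasNonposLowerCoeffs_diagonalRestriction_guanZhangPoly (by lia) hc).trailingCoeff_neg
    (j := k) ?_ ?_
  · rw [natDegree_diagonalRestriction_guanZhangPoly (by lia)]
    lia
  · rw [coeff_diagonalRestriction_guanZhangPoly_of_lt c hk, neg_lt_zero]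
    exact mul_pos hck (by exact_mod_cast Nat.choose_pos (by lia))

end Polynomials

/-! ### Elementary symmetric polynomials of corank one -/

section Penultimate

open Finset

variable {ι : Type*}

/-- The parallel sum of two numbers: the resistance of two resistors in parallel. For
nonzero `u` and `v` it satisfies `(parallel u v)⁻¹ = u⁻¹ + v⁻¹`. -/
noncomputable def parallel (u v : ℝ) : ℝ := u * v / (u + v)

theorem parallel_le {u v : ℝ} (h : 0 < u + v) (s : ℝ) :
    parallel u v ≤ (1 - s) ^ 2 * u + s ^ 2 * v := by
  rw [parallel, div_le_iff₀ h]
  linear_combination sq_nonneg ((u + v) * s - u)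

theorem parallel_eq {u v : ℝ} (h : 0 < u + v) :
    parallel u v = (1 - u / (u + v)) ^ 2 * u + (u / (u + v)) ^ 2 * v := by
  rw [parallel]
  field_simp
  ring

theorem parallel_mono {u v u' v' : ℝ} (h : 0 < u + v) (hu : u ≤ u') (hv : v ≤ v') :
    parallel u v ≤ parallel u' v' := by
  rw [parallel_eq (h.trans_le (add_le_add hu hv))]
  refine (parallel_le h (u' / (u' + v'))).trans ?_
  gcongr

theorem concaveOn_parallel :
    ConcaveOn ℝ {w : ℝ × ℝ | 0 < w.1 + w.2} fun w => parallel w.1 w.2 := by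
  have hconvex : Convex ℝ {w : ℝ × ℝ | 0 < w.1 + w.2} :=
    (convex_Ioi (0 : ℝ)).linear_preimage (LinearMap.fst ℝ ℝ ℝ + LinearMap.snd ℝ ℝ ℝ)
  refine ⟨hconvex, fun w hw w' hw' a b ha hb hab => ?_⟩
  have hmem := hconvex hw hw' ha hb hab
  generalize hz : a • w + b • w' = z at hmem
  simp only
  rw [parallel_eq hmem]
  set s := z.1 / (z.1 + z.2)
  calc a • parallel w.1 w.2 + b • parallel w'.1 w'.2
      ≤ a • ((1 - s) ^ 2 * w.1 + s ^ 2 * w.2) + b • ((1 - s) ^ 2 * w'.1 + s ^ 2 * w'.2) := by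
        gcongr
        exacts [parallel_le hw s, parallel_le hw' s]
    _ = (1 - s) ^ 2 * z.1 + s ^ 2 * z.2 := by
        simp only [← hz, Prod.fst_add, Prod.snd_add, Prod.smul_fst, Prod.smul_snd, smul_eq_mul]
        ring

variable [DecidableEq ι]

theorem superset_induction {U : Finset ι} {motive : (V : Finset ι) → U ⊆ V → Prop}
    (self : motive U Subset.rfl)
    (insert : ∀ (i : ι) (V : Finset ι) (hUV : U ⊆ V), i ∉ V → motive V hUV →
      motive (insert i V) (hUV.trans (subset_insert i V)))
    (V : Finset ι) (hUV : U ⊆ V) : motive V hUV := by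
  have motive_union : ∀ W : Finset ι, motive (W ∪ U) subset_union_right := fun W => by
    induction W using Finset.induction_on with
    | empty => simpa only [empty_union] using self
    | insert i W _ ih =>
      by_cases hi : i ∈ W ∪ U
      · simpa only [insert_union, insert_eq_of_mem hi] using ih
      · simpa only [insert_union] using insert i _ _ hi ih
  simpa only [union_eq_left.2 hUV] using motive_union V

/-- The elementary symmetric polynomial of degree `#T - 1` in the variables indexed by `T`. -/
def penultimate (T : Finset ι) (x : ι → ℝ) : ℝ := ∑ i ∈ T, ∏ j ∈ T.erase i, x j

/-- The parallel sum of the variables indexed by `T`, written as the quotient of the last two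
elementary symmetric polynomials so that it makes sense when some of the variables vanish. -/
noncomputable def parallelSum (T : Finset ι) (x : ι → ℝ) : ℝ := (∏ i ∈ T, x i) / penultimate T x

variable (ι) in
/-- The points at which `penultimate T` is positive for every nonempty `T`. -/
def penultimateCone : Set (ι → ℝ) := {x | ∀ T : Finset ι, T.Nonempty → 0 < penultimate T x}

theorem penultimate_empty (x : ι → ℝ) : penultimate ∅ x = 0 := sum_empty

@[simp] theorem penultimate_singleton (i : ι) (x : ι → ℝ) : penultimate {i} x = 1 := by
  simp [penultimate]

@[simp] theorem parallelSum_singleton (i : ι) (x : ι → ℝ) : parallelSum {i} x = x i := by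
  simp [parallelSum]

theorem penultimate_insert {i : ι} {T : Finset ι} (hi : i ∉ T) (x : ι → ℝ) :
    penultimate (insert i T) x = ∏ j ∈ T, x j + x i * penultimate T x := by
  rw [penultimate, sum_insert hi, erase_insert hi, penultimate, mul_sum]
  congr 1
  refine sum_congr rfl fun j hj => ?_
  rw [erase_insert_of_ne (ne_of_mem_of_not_mem hj hi).symm, prod_insert (by simp [hi])]

theorem penultimate_insert_eq_mul {i : ι} {T : Finset ι} (hi : i ∉ T) {x : ι → ℝ}
    (hT : penultimate T x ≠ 0) :
    penultimate (insert i T) x = penultimate T x * (x i + parallelSum T x) := by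
  rw [penultimate_insert hi, parallelSum]
  field_simp
  ring

theorem parallelSum_insert {i : ι} {T : Finset ι} (hi : i ∉ T) {x : ι → ℝ}
    (hT : penultimate T x ≠ 0) :
    parallelSum (insert i T) x = parallel (x i) (parallelSum T x) := by
  rw [parallel, ← mul_div_mul_left _ _ hT, ← penultimate_insert_eq_mul hi hT, parallelSum,
    prod_insert hi, parallelSum, mul_left_comm, mul_div_cancel₀ _ hT]

theorem continuous_penultimate (T : Finset ι) : Continuous (penultimate T) := by
  unfold penultimate
  fun_prop

theorem mem_penultimateCone_of_pos {x : ι → ℝ} (hx : ∀ i, 0 < x i) : x ∈ penultimateCone ι :=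
  fun _ hT => sum_pos (fun _ _ => prod_pos fun j _ => hx j) hT

theorem isOpen_penultimateCone [Finite ι] : IsOpen (penultimateCone ι) := by
  have : penultimateCone ι = ⋂ (T : Finset ι) (_ : T.Nonempty), {x | 0 < penultimate T x} := by
    ext x
    simp [penultimateCone]
  rw [this]
  exact isOpen_iInter_of_finite fun T => isOpen_iInter_of_finite fun _ =>
    isOpen_lt continuous_const (continuous_penultimate T)

theorem penultimate_nonneg {x : ι → ℝ} (hx : x ∈ penultimateCone ι) (U : Finset ι) :
    0 ≤ penultimate U x := by
  obtain rfl | hU := U.eq_empty_or_nonempty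
  exacts [(penultimate_empty x).ge, (hx U hU).le]

theorem add_parallelSum_pos {x : ι → ℝ} (hx : x ∈ penultimateCone ι) {i : ι} {T : Finset ι}
    (hT : T.Nonempty) (hi : i ∉ T) : 0 < x i + parallelSum T x := by
  have h := hx (insert i T) (insert_nonempty i T)
  rw [penultimate_insert_eq_mul hi (hx T hT).ne'] at h
  exact pos_of_mul_pos_right h (hx T hT).le

theorem parallelSum_anti {x : ι → ℝ} (hx : x ∈ penultimateCone ι) {U V : Finset ι}
    (hU : U.Nonempty) (hUV : U ⊆ V) : parallelSum V x ≤ parallelSum U x := by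
  induction V, hUV using superset_induction with
  | self => rfl
  | insert i V hUV hi ih =>
    have hV : V.Nonempty := hU.mono hUV
    refine le_trans ?_ ih
    rw [parallelSum_insert hi (hx V hV).ne']
    simpa using parallel_le (add_parallelSum_pos hx hV hi) 1

theorem parallelSum_le {x : ι → ℝ} (hx : x ∈ penultimateCone ι) {i : ι} {T : Finset ι}
    (hi : i ∈ T) : parallelSum T x ≤ x i := by
  simpa using parallelSum_anti hx (singleton_nonempty i) (singleton_subset_iff.2 hi)

/-- A comparison principle: a set function satisfying the recursion of `T ↦ parallelSum T z` as an
inequality is a lower bound for it, and forces `z` into the cone. -/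
theorem penultimate_pos_and_le_parallelSum {z : ι → ℝ} {q : Finset ι → ℝ}
    (hsingleton : ∀ i, q {i} ≤ z i)
    (hpos : ∀ i (T : Finset ι), T.Nonempty → i ∉ T → 0 < q {i} + q T)
    (hinsert : ∀ i (T : Finset ι), T.Nonempty → i ∉ T → q (insert i T) ≤ parallel (q {i}) (q T))
    (T : Finset ι) (hT : T.Nonempty) : 0 < penultimate T z ∧ q T ≤ parallelSum T z := by
  induction hT using Finset.Nonempty.cons_induction with
  | singleton i => simpa using hsingleton i
  | cons i T hi hT ih =>
    obtain ⟨hpen, hle⟩ := ih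
    have hsum : 0 < z i + parallelSum T z :=
      (hpos i T hT hi).trans_le (add_le_add (hsingleton i) hle)
    rw [cons_eq_insert]
    constructor
    · rw [penultimate_insert_eq_mul hi hpen.ne']
      exact mul_pos hpen hsum
    · rw [parallelSum_insert hi hpen.ne']
      exact (hinsert i T hT hi).trans (parallel_mono (hpos i T hT hi) (hsingleton i) hle)

theorem penultimate_pos_and_parallelSum_mono {x y : ι → ℝ} (hx : x ∈ penultimateCone ι)
    (hxy : x ≤ y) (T : Finset ι) (hT : T.Nonempty) :
    0 < penultimate T y ∧ parallelSum T x ≤ parallelSum T y := by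
  refine penultimate_pos_and_le_parallelSum (q := fun T => parallelSum T x)
    (fun i => by simpa using hxy i) (fun i T hT hi => ?_) (fun i T hT hi => ?_) T hT
  · simpa using add_parallelSum_pos hx hT hi
  · simpa using (parallelSum_insert hi (hx T hT).ne').le

theorem isUpperSet_penultimateCone : IsUpperSet (penultimateCone ι) :=
  fun _ _ hxy hx T hT => (penultimate_pos_and_parallelSum_mono hx hxy T hT).1

theorem monotoneOn_parallelSum {T : Finset ι} (hT : T.Nonempty) :
    MonotoneOn (parallelSum T) (penultimateCone ι) :=
  fun _ hx _ _ hxy => (penultimate_pos_and_parallelSum_mono hx hxy T hT).2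

theorem penultimate_pos_and_parallelSum_concave {x y : ι → ℝ} (hx : x ∈ penultimateCone ι)
    (hy : y ∈ penultimateCone ι) {a b : ℝ} (ha : 0 ≤ a) (hb : 0 ≤ b) (hab : a + b = 1)
    (T : Finset ι) (hT : T.Nonempty) : 0 < penultimate T (a • x + b • y) ∧
      a * parallelSum T x + b * parallelSum T y ≤ parallelSum T (a • x + b • y) := by
  refine penultimate_pos_and_le_parallelSum
    (q := fun T => a * parallelSum T x + b * parallelSum T y)
    (fun i => by simp) (fun i T hT hi => ?_) (fun i T hT hi => ?_) T hT
  · simpa using concaveOn_parallel.1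
      (x := (x i, parallelSum T x)) (add_parallelSum_pos hx hT hi)
      (y := (y i, parallelSum T y)) (add_parallelSum_pos hy hT hi) ha hb hab
  · rw [parallelSum_insert hi (hx T hT).ne', parallelSum_insert hi (hy T hT).ne']
    simpa using concaveOn_parallel.2
      (x := (x i, parallelSum T x)) (add_parallelSum_pos hx hT hi)
      (y := (y i, parallelSum T y)) (add_parallelSum_pos hy hT hi) ha hb hab

theorem convex_penultimateCone : Convex ℝ (penultimateCone ι) :=
  fun _ hx _ hy _ _ ha hb hab T hT =>
    (penultimate_pos_and_parallelSum_concave hx hy ha hb hab T hT).1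

theorem concaveOn_parallelSum {T : Finset ι} (hT : T.Nonempty) :
    ConcaveOn ℝ (penultimateCone ι) (parallelSum T) :=
  ⟨convex_penultimateCone, fun _ hx _ hy _ _ ha hb hab =>
    (penultimate_pos_and_parallelSum_concave hx hy ha hb hab T hT).2⟩

theorem concaveOn_log_comp {E : Type*} [AddCommGroup E] [Module ℝ E] {s : Set E} {g : E → ℝ}
    (hg : ConcaveOn ℝ s g) (hpos : ∀ x ∈ s, 0 < g x) :
    ConcaveOn ℝ s fun x => Real.log (g x) := by
  refine ⟨hg.1, fun x hx y hy a b ha hb hab => ?_⟩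
  refine (strictConcaveOn_log_Ioi.concaveOn.2 (hpos x hx) (hpos y hy) ha hb hab).trans
    (Real.log_le_log ?_ (hg.2 hx hy ha hb hab))
  exact (convex_Ioi (0 : ℝ)) (hpos x hx) (hpos y hy) ha hb hab

theorem convexOn_inv_of_concaveOn_log {E : Type*} [AddCommGroup E] [Module ℝ E] {s : Set E}
    {g : E → ℝ} (hg : ConcaveOn ℝ s fun x => Real.log (g x)) (hpos : ∀ x ∈ s, 0 < g x) :
    ConvexOn ℝ s fun x => (g x)⁻¹ := by
  have hexp : ConvexOn ℝ s fun x => Real.exp (-Real.log (g x)) :=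
    ⟨hg.1, fun x hx y hy a b ha hb hab => (Real.exp_le_exp.2 (hg.neg.2 hx hy ha hb hab)).trans
      (convexOn_exp.2 (Set.mem_univ _) (Set.mem_univ _) ha hb hab)⟩
  exact hexp.congr fun x hx => by simp only [Real.exp_neg, Real.exp_log (hpos x hx)]

theorem concaveOn_log_penultimate_div {U V : Finset ι} (hU : U.Nonempty) (hUV : U ⊆ V) :
    ConcaveOn ℝ (penultimateCone ι) fun x => Real.log (penultimate V x / penultimate U x) := by
  induction V, hUV using superset_induction with
  | self =>
    refine (concaveOn_const (0 : ℝ) convex_penultimateCone).congr fun x hx => ?_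
    rw [div_self (hx U hU).ne', Real.log_one]
  | insert i V hUV hi ih =>
    have hV : V.Nonempty := hU.mono hUV
    have hcoord : ConcaveOn ℝ (penultimateCone ι) fun x : ι → ℝ => x i :=
      (LinearMap.proj (R := ℝ) (φ := fun _ : ι => ℝ) i).concaveOn convex_penultimateCone
    have hfactor := concaveOn_log_comp (hcoord.add (concaveOn_parallelSum hV))
      fun x hx => add_parallelSum_pos hx hV hi
    refine (ih.add hfactor).congr fun x hx => ?_
    rw [penultimate_insert_eq_mul hi (hx V hV).ne', mul_div_right_comm,
      Real.log_mul (div_pos (hx V hV) (hx U hU)).ne' (add_parallelSum_pos hx hV hi).ne']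
    rfl

theorem convexOn_penultimate_div {U V : Finset ι} (hUV : U ⊆ V) :
    ConvexOn ℝ (penultimateCone ι) fun x => penultimate U x / penultimate V x := by
  obtain rfl | hU := U.eq_empty_or_nonempty
  · simpa only [penultimate_empty, zero_div] using convexOn_const (0 : ℝ) convex_penultimateCone
  · simpa only [inv_div] using convexOn_inv_of_concaveOn_log (concaveOn_log_penultimate_div hU hUV)
      fun x hx => div_pos (hx V (hU.mono hUV)) (hx U hU)

theorem antitoneOn_penultimate_div {U V : Finset ι} (hUV : U ⊆ V) :
    AntitoneOn (fun x => penultimate U x / penultimate V x) (penultimateCone ι) := by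
  intro x hx y hy hxy
  obtain rfl | hU := U.eq_empty_or_nonempty
  · simp only [penultimate_empty, zero_div, le_refl]
  induction V, hUV using superset_induction with
  | self => simp only [div_self (hx U hU).ne', div_self (hy U hU).ne', le_refl]
  | insert i V hUV hi ih =>
    have hV : V.Nonempty := hU.mono hUV
    simp only [penultimate_insert_eq_mul hi (hx V hV).ne',
      penultimate_insert_eq_mul hi (hy V hV).ne', ← div_div]
    exact div_le_div₀ (div_nonneg (hx U hU).le (hx V hV).le) ih (add_parallelSum_pos hx hV hi)
      (add_le_add (hxy i) (monotoneOn_parallelSum hV hx hy hxy))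

theorem penultimate_div_lt_of_lt {U V : Finset ι} (hU : U.Nonempty) (hUV : U ⊆ V) {i : ι}
    (hiU : i ∉ U) (hiV : i ∈ V) {x y : ι → ℝ} (hx : x ∈ penultimateCone ι) (hxy : x ≤ y)
    (hlt : x i < y i) : penultimate U y / penultimate V y < penultimate U x / penultimate V x := by
  have hy : y ∈ penultimateCone ι := isUpperSet_penultimateCone hxy hx
  have hsub : U ⊆ V.erase i := subset_erase.2 ⟨hUV, hiU⟩
  have hW : (V.erase i).Nonempty := hU.mono hsub
  have hi : i ∉ V.erase i := notMem_erase i V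
  rw [← insert_erase hiV, penultimate_insert_eq_mul hi (hx _ hW).ne',
    penultimate_insert_eq_mul hi (hy _ hW).ne', ← div_div, ← div_div]
  exact div_lt_div₀' (antitoneOn_penultimate_div hsub hx hy hxy)
    (add_lt_add_of_lt_of_le hlt (monotoneOn_parallelSum hW hx hy hxy))
    (div_pos (hx U hU) (hx _ hW)) (add_parallelSum_pos hx hW hi)

theorem penultimate_le_norm_pow_mul [Fintype ι] {x : ι → ℝ} (hx : x ∈ penultimateCone ι)
    {U V : Finset ι} (hU : U.Nonempty) (hUV : U ⊆ V) :
    penultimate V x ≤ (2 * ‖x‖) ^ #(V \ U) * penultimate U x := by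
  have coord_le_norm : ∀ i, x i ≤ ‖x‖ := fun i => (le_abs_self _).trans (norm_le_pi_norm x i)
  induction V, hUV using superset_induction with
  | self => simp
  | insert i V hUV hi ih =>
    obtain ⟨j, hj⟩ := hU.mono hUV
    have hfactor : x i + parallelSum V x ≤ 2 * ‖x‖ := by
      linarith [coord_le_norm i, (parallelSum_le hx hj).trans (coord_le_norm j)]
    rw [penultimate_insert_eq_mul hi (hx V ⟨j, hj⟩).ne',
      insert_sdiff_of_notMem _ (fun h => hi (hUV h)), card_insert_of_notMem (by simp [hi]),
      pow_succ, mul_right_comm]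
    exact mul_le_mul ih hfactor (add_parallelSum_pos hx ⟨j, hj⟩ hi).le
      (mul_nonneg (by positivity) (hx U hU).le)

end Penultimate

/-! ### The convex positive region -/

section PositiveRegion

open Finset Filter Topology

variable {ι : Type*} [DecidableEq ι] [Fintype ι]

/-- The product of all variables, plus `c` times the elementary symmetric polynomial of degree one
less, minus the combination of the polynomials `penultimate U` with coefficients `a U`. -/
def penultimateComb (c : ℝ) (a : Finset ι → ℝ) (x : ι → ℝ) : ℝ :=
  ∏ i, x i + c * penultimate univ x - ∑ U, a U * penultimate U x

/-- The part of the positivity set of `penultimateComb c a` in the cone `penultimateCone ι`. -/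
def positiveRegion (c : ℝ) (a : Finset ι → ℝ) : Set (ι → ℝ) :=
  {x | x ∈ penultimateCone ι ∧ 0 < penultimateComb c a x}

/-- The quotient of `penultimateComb c a` by `penultimate univ`, which is concave and increasing on
the cone when `a` is admissible. -/
noncomputable def combQuotient (c : ℝ) (a : Finset ι → ℝ) (x : ι → ℝ) : ℝ :=
  parallelSum univ x + c - ∑ U, a U * (penultimate U x / penultimate univ x)

/-- The weights `a` for which `combQuotient c a` is strictly increasing in each variable `x i`:
they are nonnegative, and one of the polynomials without `x i` has a positive weight. -/
structure IsAdmissible (a : Finset ι → ℝ) : Prop where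
  nonneg : ∀ U, 0 ≤ a U
  exists_pos : ∀ i, ∃ U : Finset ι, U.Nonempty ∧ i ∉ U ∧ 0 < a U

variable {c : ℝ} {a : Finset ι → ℝ}

theorem continuous_penultimateComb : Continuous (penultimateComb c a) := by
  have := continuous_penultimate (ι := ι)
  unfold penultimateComb
  fun_prop

theorem isOpen_positiveRegion : IsOpen (positiveRegion c a) :=
  isOpen_penultimateCone.inter (isOpen_lt continuous_const continuous_penultimateComb)

variable [Nonempty ι]

theorem penultimateComb_eq_mul {x : ι → ℝ} (hx : x ∈ penultimateCone ι) :
    penultimateComb c a x = penultimate univ x * combQuotient c a x := by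
  have huniv : penultimate univ x ≠ 0 := (hx univ univ_nonempty).ne'
  rw [penultimateComb, combQuotient, parallelSum, mul_sub, mul_add, mul_div_cancel₀ _ huniv,
    mul_sum, mul_comm c]
  simp only [mul_left_comm _ (a _), mul_div_cancel₀ _ huniv]

theorem mem_positiveRegion_iff {x : ι → ℝ} :
    x ∈ positiveRegion c a ↔ x ∈ penultimateCone ι ∧ 0 < combQuotient c a x := by
  refine and_congr_right fun hx => ?_
  rw [penultimateComb_eq_mul hx, mul_pos_iff_of_pos_left (hx univ univ_nonempty)]

theorem concaveOn_combQuotient (ha : ∀ U, 0 ≤ a U) :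
    ConcaveOn ℝ (penultimateCone ι) (combQuotient c a) := by
  refine ((concaveOn_parallelSum univ_nonempty).add
    (concaveOn_const c convex_penultimateCone)).sub ?_
  refine ⟨convex_penultimateCone, fun x hx y hy s t hs ht hst => ?_⟩
  simp only [smul_sum, ← sum_add_distrib]
  exact sum_le_sum fun U _ =>
    ((convexOn_penultimate_div (subset_univ U)).smul (ha U)).2 hx hy hs ht hst

theorem convex_positiveRegion (ha : ∀ U, 0 ≤ a U) : Convex ℝ (positiveRegion c a) := by
  have h : positiveRegion c a = {x ∈ penultimateCone ι | 0 < combQuotient c a x} :=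
    Set.ext fun _ => mem_positiveRegion_iff
  exact h ▸ (concaveOn_combQuotient ha).convex_gt 0

theorem mul_penultimate_lt (ha : ∀ U, 0 ≤ a U) {x : ι → ℝ} (hx : x ∈ positiveRegion c a) (i : ι)
    (U : Finset ι) : a U * penultimate U x < (x i + c) * penultimate univ x := by
  obtain ⟨hcone, hquot⟩ := mem_positiveRegion_iff.1 hx
  rw [← div_lt_iff₀ (hcone univ univ_nonempty), mul_div_assoc]
  calc a U * (penultimate U x / penultimate univ x)
      ≤ ∑ V, a V * (penultimate V x / penultimate univ x) :=
        single_le_sum (f := fun V => a V * (penultimate V x / penultimate univ x))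
          (fun V _ => mul_nonneg (ha V)
            (div_nonneg (penultimate_nonneg hcone V) (penultimate_nonneg hcone univ))) (mem_univ U)
    _ < parallelSum univ x + c := sub_pos.1 hquot
    _ ≤ x i + c := by gcongr; exact parallelSum_le hcone (mem_univ i)

theorem neg_lt_of_mem_positiveRegion (ha : ∀ U, 0 ≤ a U) {x : ι → ℝ}
    (hx : x ∈ positiveRegion c a) (i : ι) : -c < x i := by
  have h := mul_penultimate_lt ha hx i ∅
  rw [penultimate_empty, mul_zero, mul_pos_iff_of_pos_right (hx.1 univ univ_nonempty)] at h
  linarith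

theorem bddBelow_positiveRegion (ha : ∀ U, 0 ≤ a U) : BddBelow (positiveRegion c a) :=
  ⟨fun _ => -c, fun _ hx i => (neg_lt_of_mem_positiveRegion ha hx i).le⟩

theorem bddBelow_frontier_positiveRegion (ha : ∀ U, 0 ≤ a U) :
    BddBelow (frontier (positiveRegion c a)) :=
  (bddBelow_positiveRegion ha).closure.mono frontier_subset_closure

theorem weight_le_mul_add_parallelSum_erase (ha : ∀ U, 0 ≤ a U) {x : ι → ℝ}
    (hx : x ∈ positiveRegion c a) {i : ι} {U : Finset ι} (hU : U.Nonempty) (hiU : i ∉ U) :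
    a U ≤ (‖x‖ + c) * (2 * ‖x‖) ^ #(univ.erase i \ U) *
      (x i + parallelSum (univ.erase i) x) := by
  have hsub : U ⊆ univ.erase i := subset_erase.2 ⟨subset_univ U, hiU⟩
  have herase : (univ.erase i).Nonempty := hU.mono hsub
  have hi : i ∉ univ.erase i := notMem_erase i univ
  have hxi : 0 < x i + c := by linarith [neg_lt_of_mem_positiveRegion ha hx i]
  have hnorm : x i ≤ ‖x‖ := (le_abs_self _).trans (norm_le_pi_norm x i)
  refine le_of_mul_le_mul_right ?_ (hx.1 U hU)
  calc a U * penultimate U x ≤ (x i + c) * penultimate univ x :=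
        (mul_penultimate_lt ha hx i U).le
    _ = (x i + c) * (penultimate (univ.erase i) x * (x i + parallelSum (univ.erase i) x)) := by
        rw [← penultimate_insert_eq_mul hi (hx.1 _ herase).ne', insert_erase (mem_univ i)]
    _ ≤ (‖x‖ + c) * ((2 * ‖x‖) ^ #(univ.erase i \ U) * penultimate U x *
          (x i + parallelSum (univ.erase i) x)) := by
        have hfactor := (add_parallelSum_pos hx.1 herase hi).le
        refine mul_le_mul (by gcongr) ?_ (mul_nonneg (hx.1 _ herase).le hfactor) (by linarith)
        exact mul_le_mul_of_nonneg_right (penultimate_le_norm_pow_mul hx.1 hU hsub) hfactor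
    _ = _ := by ring

theorem weight_mul_penultimate_le (ha : ∀ U, 0 ≤ a U) {x : ι → ℝ} (hx : x ∈ positiveRegion c a)
    {i : ι} {U T : Finset ι} (hU : U.Nonempty) (hiU : i ∉ U) (hT : T.Nonempty) (hiT : i ∉ T) :
    a U * penultimate T x ≤
      (‖x‖ + c) * (2 * ‖x‖) ^ #(univ.erase i \ U) * penultimate (insert i T) x := by
  have hnorm : 0 < ‖x‖ + c := by
    linarith [neg_lt_of_mem_positiveRegion ha hx i, (le_abs_self _).trans (norm_le_pi_norm x i)]
  rw [penultimate_insert_eq_mul hiT (hx.1 T hT).ne', mul_left_comm, mul_comm (a U)]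
  refine mul_le_mul_of_nonneg_left
    ((weight_le_mul_add_parallelSum_erase ha hx hU hiU).trans ?_) (hx.1 T hT).le
  gcongr
  exact parallelSum_anti hx.1 hT (subset_erase.2 ⟨subset_univ T, hiT⟩)

namespace IsAdmissible

theorem closure_positiveRegion_subset (ha : IsAdmissible a) :
    closure (positiveRegion c a) ⊆ penultimateCone ι := by
  intro x hx T hT
  induction hT using Finset.Nonempty.cons_induction with
  | singleton i => simp
  | cons i T hiT hT ih =>
    rw [cons_eq_insert]
    obtain ⟨U, hU, hiU, haU⟩ := ha.exists_pos i
    have hcont := continuous_penultimate (ι := ι)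
    have hnonneg : 0 ≤ penultimate (insert i T) x :=
      closure_minimal (fun y hy => (hy.1 (insert i T) (insert_nonempty i T)).le)
        (isClosed_le continuous_const (hcont _)) hx
    have hle : a U * penultimate T x ≤
        (‖x‖ + c) * (2 * ‖x‖) ^ #(univ.erase i \ U) * penultimate (insert i T) x :=
      closure_minimal (t := {y | a U * penultimate T y ≤
          (‖y‖ + c) * (2 * ‖y‖) ^ #(univ.erase i \ U) * penultimate (insert i T) y})
        (fun y hy => weight_mul_penultimate_le ha.nonneg hy hU hiU hT hiT)
        (isClosed_le (by fun_prop) (by fun_prop)) hx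
    exact hnonneg.lt_of_ne' (right_ne_zero_of_mul ((mul_pos haU ih).trans_le hle).ne')

theorem combQuotient_lt (ha : IsAdmissible a) {x y : ι → ℝ} (hx : x ∈ penultimateCone ι)
    (hxy : x < y) : combQuotient c a x < combQuotient c a y := by
  obtain ⟨hle, i, hi⟩ := Pi.lt_def.1 hxy
  have hy : y ∈ penultimateCone ι := isUpperSet_penultimateCone hle hx
  obtain ⟨U, hU, hiU, haU⟩ := ha.exists_pos i
  have hparallel := monotoneOn_parallelSum univ_nonempty hx hy hle
  have hsum : ∑ V, a V * (penultimate V y / penultimate univ y) <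
      ∑ V, a V * (penultimate V x / penultimate univ x) :=
    sum_lt_sum
      (fun V _ => mul_le_mul_of_nonneg_left
        (antitoneOn_penultimate_div (subset_univ V) hx hy hle) (ha.nonneg V))
      ⟨U, mem_univ U, mul_lt_mul_of_pos_left
        (penultimate_div_lt_of_lt hU (subset_univ U) hiU (mem_univ i) hx hle hi) haU⟩
  unfold combQuotient
  linarith

theorem mem_positiveRegion_of_lt (ha : IsAdmissible a) {x y : ι → ℝ}
    (hx : x ∈ penultimateCone ι) (hnonneg : 0 ≤ penultimateComb c a x) (hxy : x < y) :
    y ∈ positiveRegion c a := by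
  rw [penultimateComb_eq_mul hx, mul_nonneg_iff_of_pos_left (hx univ univ_nonempty)] at hnonneg
  exact mem_positiveRegion_iff.2
    ⟨isUpperSet_penultimateCone hxy.le hx, hnonneg.trans_lt (ha.combQuotient_lt hx hxy)⟩

theorem isUpperSet_positiveRegion (ha : IsAdmissible a) : IsUpperSet (positiveRegion c a) := by
  intro x y hxy hx
  obtain rfl | hlt := hxy.eq_or_lt
  exacts [hx, ha.mem_positiveRegion_of_lt hx.1 hx.2.le hlt]

theorem frontier_positiveRegion (ha : IsAdmissible a) :
    frontier (positiveRegion c a) = {x | x ∈ penultimateCone ι ∧ penultimateComb c a x = 0} := by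
  rw [isOpen_positiveRegion.frontier_eq]
  ext x
  constructor
  · rintro ⟨hx, hnx⟩
    have hcone := ha.closure_positiveRegion_subset hx
    have hnonneg : 0 ≤ penultimateComb c a x := closure_minimal (fun y hy => hy.2.le)
      (isClosed_le continuous_const continuous_penultimateComb) hx
    exact ⟨hcone, (not_lt.1 fun hpos => hnx ⟨hcone, hpos⟩).antisymm hnonneg⟩
  · rintro ⟨hcone, hzero⟩
    refine ⟨?_, fun hx => hx.2.ne' hzero⟩
    have hlim : Tendsto (fun t : ℝ => x + t • 1) (𝓝[>] 0) (𝓝 x) := by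
      refine Tendsto.mono_left ?_ nhdsWithin_le_nhds
      exact Continuous.tendsto' (by fun_prop) _ _ (by simp)
    refine mem_closure_of_tendsto hlim (eventually_of_mem self_mem_nhdsWithin fun t ht => ?_)
    exact ha.mem_positiveRegion_of_lt hcone hzero.ge
      (lt_add_of_pos_right x (smul_pos ht one_pos))

end IsAdmissible

end PositiveRegion

/-! ### Connected components and frontiers of upper sets -/

section Topology

open Set

theorem connectedComponentIn_eq_inter {X : Type*} [TopologicalSpace X] {u S : Set X} {x : X}
    (hu : IsOpen u) (hpre : IsPreconnected (u ∩ S)) (hclosure : closure (u ∩ S) ∩ S ⊆ u)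
    (hx : x ∈ u ∩ S) : connectedComponentIn S x = u ∩ S := by
  refine Subset.antisymm (fun y hy => ?_) (hpre.subset_connectedComponentIn hx inter_subset_right)
  have hS := connectedComponentIn_subset S x
  by_contra hyn
  have hy_notMem : y ∉ closure (u ∩ S) := fun hcl => hyn ⟨hclosure ⟨hcl, hS hy⟩, hS hy⟩
  obtain ⟨z, hz, hzu, hz_notMem⟩ := isPreconnected_connectedComponentIn (x := x) (F := S)
    u (closure (u ∩ S))ᶜ hu isClosed_closure.isOpen_compl
    (fun z hz => or_iff_not_imp_right.2 fun hcl => hclosure ⟨not_not.1 hcl, hS hz⟩)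
    ⟨x, mem_connectedComponentIn hx.2, hx.1⟩ ⟨y, hy, hy_notMem⟩
  exact hz_notMem (subset_closure ⟨hzu, hS hz⟩)

theorem apply_mem_connectedComponentIn {X Y : Type*} [TopologicalSpace X] [TopologicalSpace Y]
    {γ : Y → X} {I : Set Y} {S : Set X} {x : X} {a b : Y} (hI : IsPreconnected I)
    (hγ : ContinuousOn γ I) (hS : ∀ t ∈ I, γ t ∈ S) (ha : a ∈ I) (hb : b ∈ I) (hx : γ a = x) :
    γ b ∈ connectedComponentIn S x :=
  (hI.image γ hγ).subset_connectedComponentIn ⟨a, ha, hx⟩ (image_subset_iff.2 hS) ⟨b, hb, rfl⟩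

variable {κ : Type*} {s : Set (κ → ℝ)}

theorem not_bddBelow_of_forall_exists_apply_eq {i : κ} {r : ℝ}
    (h : ∀ t ≤ r, ∃ x ∈ s, x i = t) : ¬ BddBelow s := by
  rintro ⟨q, hq⟩
  obtain ⟨x, hx, hxi⟩ := h (min r (q i - 1)) (min_le_left _ _)
  linarith [hq hx i, min_le_right r (q i - 1)]

/-- The parameter at which the line through `x` in the direction `(1, …, 1)` enters the upper
set `s`. -/
noncomputable def diagonalHeight (s : Set (κ → ℝ)) (x : κ → ℝ) : ℝ := sInf {t : ℝ | x + t • 1 ∈ s}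

theorem bddBelow_setOf_add_smul_one_mem [Nonempty κ] (hb : BddBelow s) (x : κ → ℝ) :
    BddBelow {t : ℝ | x + t • 1 ∈ s} := by
  obtain ⟨q, hq⟩ := hb
  inhabit κ
  refine ⟨q default - x default, fun t ht => ?_⟩
  have := hq ht default
  simp only [Pi.add_apply, Pi.smul_apply, Pi.one_apply, smul_eq_mul, mul_one] at this
  linarith

theorem le_add_dist_smul_one [Fintype κ] (x y : κ → ℝ) : y ≤ x + dist x y • 1 := by
  intro i
  have := (neg_le_abs (x i - y i)).trans (dist_le_pi_dist x y i)
  simp only [Pi.add_apply, Pi.smul_apply, Pi.one_apply, smul_eq_mul, mul_one]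
  linarith

variable [Finite κ]

theorem nonempty_setOf_add_smul_one_mem (hs : IsUpperSet s) (hne : s.Nonempty) (x : κ → ℝ) :
    {t : ℝ | x + t • 1 ∈ s}.Nonempty := by
  cases nonempty_fintype κ
  obtain ⟨y, hy⟩ := hne
  exact ⟨dist x y, hs (le_add_dist_smul_one x y) hy⟩

theorem mem_of_diagonalHeight_neg (hs : IsUpperSet s) (hne : s.Nonempty) {x : κ → ℝ}
    (hx : diagonalHeight s x < 0) : x ∈ s := by
  obtain ⟨t, ht, ht0⟩ := exists_lt_of_csInf_lt (nonempty_setOf_add_smul_one_mem hs hne x) hx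
  exact hs (add_le_of_nonpos_right (smul_nonpos_of_nonpos_of_nonneg ht0.le zero_le_one)) ht

variable [Nonempty κ]

theorem continuous_diagonalHeight (hs : IsUpperSet s) (hne : s.Nonempty) (hb : BddBelow s) :
    Continuous (diagonalHeight s) := by
  cases nonempty_fintype κ
  refine (LipschitzWith.of_le_add fun x y => ?_).continuous
  rw [← sub_le_iff_le_add]
  refine le_csInf (nonempty_setOf_add_smul_one_mem hs hne y) fun t ht => ?_
  rw [sub_le_iff_le_add]
  refine csInf_le (bddBelow_setOf_add_smul_one_mem hb x) (hs ?_ ht)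
  calc y + t • 1 ≤ x + dist x y • 1 + t • 1 := by grw [← le_add_dist_smul_one x y]
    _ = x + (t + dist x y) • 1 := by rw [add_smul, add_comm (t • _), add_assoc]

theorem diagonalHeight_eq_zero_of_mem_frontier (hs : IsUpperSet s) (ho : IsOpen s)
    (hne : s.Nonempty) (hb : BddBelow s) {x : κ → ℝ} (hx : x ∈ frontier s) :
    diagonalHeight s x = 0 := by
  rw [ho.frontier_eq] at hx
  refine le_antisymm ?_ (not_lt.1 fun hneg => hx.2 (mem_of_diagonalHeight_neg hs hne hneg))
  have hsub : s ⊆ {y | diagonalHeight s y ≤ 0} := fun y hy =>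
    csInf_le (bddBelow_setOf_add_smul_one_mem hb y) (by simpa using hy)
  exact closure_minimal hsub
    (isClosed_le (continuous_diagonalHeight hs hne hb) continuous_const) hx.1

theorem add_diagonalHeight_smul_mem_frontier (hs : IsUpperSet s) (ho : IsOpen s)
    (hne : s.Nonempty) (hb : BddBelow s) (x : κ → ℝ) :
    x + diagonalHeight s x • 1 ∈ frontier s := by
  have hbelow := bddBelow_setOf_add_smul_one_mem hb x
  have hline : Continuous fun t : ℝ => x + t • (1 : κ → ℝ) := by fun_prop
  rw [ho.frontier_eq]
  refine ⟨map_mem_closure (f := fun t : ℝ => x + t • 1) hline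
    (csInf_mem_closure (nonempty_setOf_add_smul_one_mem hs hne x) hbelow) fun t ht => ht, ?_⟩
  intro hmem
  obtain ⟨t, hlt, ht⟩ := (hline.continuousAt.eventually_mem (ho.mem_nhds hmem)).exists_lt
  exact hlt.not_ge (csInf_le hbelow ht)

theorem isPreconnected_frontier_of_isUpperSet (hs : IsUpperSet s) (ho : IsOpen s)
    (hne : s.Nonempty) (hb : BddBelow s) : IsPreconnected (frontier s) := by
  have hrange : frontier s = range fun x => x + diagonalHeight s x • 1 := by
    refine Subset.antisymm (fun x hx => ⟨x, ?_⟩)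
      (range_subset_iff.2 (add_diagonalHeight_smul_mem_frontier hs ho hne hb))
    simp only [diagonalHeight_eq_zero_of_mem_frontier hs ho hne hb hx, zero_smul, add_zero]
  have := continuous_diagonalHeight hs hne hb
  exact hrange ▸ isPreconnected_range (by fun_prop)

end Topology

/-! ### Level sets of multiaffine functions -/

section Multiaffine

open Finset Function

variable {ι : Type*} [DecidableEq ι]

/-- `F` is an affine function of each of its variables. -/
def IsMultiaffine (F : (ι → ℝ) → ℝ) : Prop :=
  ∀ x i t, F (update x i t) = (1 - t) * F (update x i 0) + t * F (update x i 1)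

/-- The slope of a multiaffine function in the `i`-th variable, that is, its `i`-th partial
derivative. -/
def slopeAt (F : (ι → ℝ) → ℝ) (i : ι) (x : ι → ℝ) : ℝ := F (update x i 1) - F (update x i 0)

variable {F G : (ι → ℝ) → ℝ}

theorem slopeAt_update_self (F : (ι → ℝ) → ℝ) (i : ι) (x : ι → ℝ) (t : ℝ) :
    slopeAt F i (update x i t) = slopeAt F i x := by
  simp only [slopeAt, update_idem]

theorem slopeAt_slopeAt_comm (F : (ι → ℝ) → ℝ) (i j : ι) (x : ι → ℝ) :
    slopeAt (slopeAt F j) i x = slopeAt (slopeAt F i) j x := by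
  obtain rfl | hij := eq_or_ne i j
  · rfl
  · simp only [slopeAt, update_comm hij]
    ring

theorem continuous_slopeAt (hF : Continuous F) (i : ι) : Continuous (slopeAt F i) := by
  unfold slopeAt
  fun_prop

namespace IsMultiaffine

theorem const_mul (hF : IsMultiaffine F) (r : ℝ) : IsMultiaffine fun x => r * F x := by
  intro x i t
  simp only [hF x i t]
  ring

theorem add (hF : IsMultiaffine F) (hG : IsMultiaffine G) : IsMultiaffine fun x => F x + G x := by
  intro x i t
  simp only [hF x i t, hG x i t]
  ring

theorem sub (hF : IsMultiaffine F) (hG : IsMultiaffine G) : IsMultiaffine fun x => F x - G x := by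
  intro x i t
  simp only [hF x i t, hG x i t]
  ring

theorem sum {κ : Type*} {s : Finset κ} {H : κ → (ι → ℝ) → ℝ} (h : ∀ k ∈ s, IsMultiaffine (H k)) :
    IsMultiaffine fun x => ∑ k ∈ s, H k x := by
  intro x i t
  simp only [mul_sum, ← sum_add_distrib]
  exact sum_congr rfl fun k hk => h k hk x i t

theorem prod (T : Finset ι) : IsMultiaffine fun x => ∏ i ∈ T, x i := by
  intro x i t
  by_cases hi : i ∈ T
  · simp only [prod_update_of_mem hi]
    ring
  · simp only [prod_update_of_notMem hi]
    ring

theorem update_eq (hF : IsMultiaffine F) (x : ι → ℝ) (i : ι) (t : ℝ) :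
    F (update x i t) = F x + (t - x i) * slopeAt F i x := by
  have h := hF x i (x i)
  rw [update_eq_self] at h
  rw [hF x i t, h, slopeAt]
  ring

end IsMultiaffine

theorem isMultiaffine_slopeAt (hF : IsMultiaffine F) (j : ι) : IsMultiaffine (slopeAt F j) := by
  intro x i t
  obtain rfl | hij := eq_or_ne i j
  · simp only [slopeAt_update_self]
    ring
  · simp only [slopeAt, update_comm hij, hF _ i t]
    ring

theorem isMultiaffine_penultimate (T : Finset ι) : IsMultiaffine (penultimate T) :=
  IsMultiaffine.sum fun i _ => IsMultiaffine.prod (T.erase i)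

theorem isMultiaffine_penultimateComb [Fintype ι] (c : ℝ) (a : Finset ι → ℝ) :
    IsMultiaffine (penultimateComb c a) :=
  ((IsMultiaffine.prod univ).add ((isMultiaffine_penultimate univ).const_mul c)).sub
    (IsMultiaffine.sum fun U _ => (isMultiaffine_penultimate U).const_mul (a U))

theorem mul_pos_trans {a b c : ℝ} (hab : 0 < a * b) (hbc : 0 < b * c) : 0 < a * c := by
  refine pos_of_mul_pos_left ?_ (mul_self_nonneg b)
  linear_combination mul_pos hab hbc

theorem isUpperSet_of_update_mem [Finite ι] {C : Set (ι → ℝ)}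
    (h : ∀ x ∈ C, ∀ i t, x i ≤ t → update x i t ∈ C) : IsUpperSet C := by
  cases nonempty_fintype ι
  intro x z hxz hx
  have hpiecewise (T : Finset ι) : T.piecewise z x ∈ C := by
    induction T using Finset.induction_on with
    | empty => rwa [piecewise_empty]
    | insert i T hi ih =>
      rw [piecewise_insert]
      exact h _ ih i (z i) (by simpa only [piecewise_eq_of_notMem _ _ _ hi] using hxz i)
  simpa only [piecewise_univ] using hpiecewise univ

theorem update_mem_connectedComponentIn {S : Set (ι → ℝ)} {y : ι → ℝ} {i : ι} {I : Set ℝ} {t : ℝ}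
    (hI : IsPreconnected I) (hS : ∀ s ∈ I, update y i s ∈ S) (hy : y i ∈ I) (ht : t ∈ I) :
    update y i t ∈ connectedComponentIn S y :=
  apply_mem_connectedComponentIn hI (by fun_prop) hS hy ht (update_eq_self i y)

namespace IsMultiaffine

theorem slopeAt_nonneg_of_bddBelow (hF : IsMultiaffine F) {y : ι → ℝ} (hy : 0 < F y)
    (hb : BddBelow (connectedComponentIn {z | 0 < F z} y)) (i : ι) : 0 ≤ slopeAt F i y := by
  by_contra! hneg
  refine not_bddBelow_of_forall_exists_apply_eq (i := i) (r := y i) (fun t ht =>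
    ⟨update y i t, update_mem_connectedComponentIn isPreconnected_Iic (fun s hs => ?_)
      Set.self_mem_Iic ht, update_self i t y⟩) hb
  rw [Set.mem_ofPred_eq, hF.update_eq]
  exact add_pos_of_pos_of_nonneg hy
    (mul_nonneg_of_nonpos_of_nonpos (sub_nonpos.2 hs) hneg.le)

theorem isUpperSet_positive_component [Finite ι] (hF : IsMultiaffine F) {x : ι → ℝ}
    (hb : BddBelow (connectedComponentIn {z | 0 < F z} x)) :
    IsUpperSet (connectedComponentIn {z | 0 < F z} x) := by
  refine isUpperSet_of_update_mem fun y hy i t ht => ?_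
  have hpos : 0 < F y := connectedComponentIn_subset {z | 0 < F z} x hy
  rw [connectedComponentIn_eq hy] at hb ⊢
  refine update_mem_connectedComponentIn isPreconnected_Ici (fun s hs => ?_) Set.self_mem_Ici ht
  rw [Set.mem_ofPred_eq, hF.update_eq]
  exact add_pos_of_pos_of_nonneg hpos
    (mul_nonneg (sub_nonneg.2 hs) (hF.slopeAt_nonneg_of_bddBelow hpos hb i))

theorem slopeAt_ne_zero_of_bddBelow (hF : IsMultiaffine F) {y : ι → ℝ} (hy : F y = 0)
    (hb : BddBelow (connectedComponentIn {z | F z = 0} y)) (i : ι) :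
    slopeAt F i y ≠ 0 := by
  intro hslope
  refine not_bddBelow_of_forall_exists_apply_eq (i := i) (r := y i) (fun t _ =>
    ⟨update y i t, update_mem_connectedComponentIn isPreconnected_univ (fun s _ => ?_)
      (Set.mem_univ _) (Set.mem_univ t), update_self i t y⟩) hb
  rw [Set.mem_ofPred_eq, hF.update_eq, hy, hslope, mul_zero, add_zero]

/-- The `j`-th coordinate is the zero of the affine function `F (update (update y i t) j ·)`. -/
theorem hyperbola_mem_connectedComponentIn (hF : IsMultiaffine F) {y : ι → ℝ} (hy : F y = 0)
    {i j : ι} (hij : i ≠ j) {I : Set ℝ} {t : ℝ} (hI : IsPreconnected I) (hyI : y i ∈ I)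
    (ht : t ∈ I) (hslope : ∀ s ∈ I, slopeAt F j (update y i s) ≠ 0) :
    update (update y i t) j
      (y j - (t - y i) * slopeAt F i y / slopeAt F j (update y i t)) ∈
        connectedComponentIn {z | F z = 0} y := by
  have hcont : ContinuousOn (fun s => y j - (s - y i) * slopeAt F i y /
      slopeAt F j (update y i s)) I := by
    simp only [(isMultiaffine_slopeAt hF j).update_eq] at hslope ⊢
    fun_prop (disch := assumption)
  refine apply_mem_connectedComponentIn (γ := fun s => update (update y i s) j (y j -
    (s - y i) * slopeAt F i y / slopeAt F j (update y i s))) hI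
    (by fun_prop) (fun s hs => ?_) hyI ht (by simp)
  have := hslope s hs
  rw [Set.mem_ofPred_eq, hF.update_eq (update y i s) j, hF.update_eq y i s,
    update_of_ne hij.symm, hy]
  field_simp
  ring

theorem slopeAt_mul_slopeAt_update_pos (hF : IsMultiaffine F) {y : ι → ℝ} {i j : ι} {t : ℝ}
    (hslope : slopeAt F j y ≠ 0)
    (ht : 0 ≤ (t - y i) * (slopeAt (slopeAt F j) i y * slopeAt F j y)) :
    0 < slopeAt F j y * slopeAt F j (update y i t) := by
  rw [(isMultiaffine_slopeAt hF j).update_eq]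
  linear_combination ht + mul_self_pos.2 hslope

theorem slopeAt_slopeAt_mul_pos (hF : IsMultiaffine F) {y : ι → ℝ} (hy : F y = 0)
    (hb : BddBelow (connectedComponentIn {z | F z = 0} y)) {i j : ι} (hij : i ≠ j) :
    0 < slopeAt (slopeAt F j) i y * slopeAt F j y := by
  by_contra! hle
  have hslope := hF.slopeAt_ne_zero_of_bddBelow hy hb j
  refine not_bddBelow_of_forall_exists_apply_eq (i := i) (r := y i) (fun t ht =>
    ⟨_, hF.hyperbola_mem_connectedComponentIn hy hij isPreconnected_Iic Set.self_mem_Iic ht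
      fun s hs => ?_, by rw [update_of_ne hij, update_self]⟩) hb
  exact right_ne_zero_of_mul (hF.slopeAt_mul_slopeAt_update_pos hslope
    (mul_nonneg_of_nonpos_of_nonpos (sub_nonpos.2 hs) hle)).ne'

theorem exists_update_update_mem (hF : IsMultiaffine F) {y : ι → ℝ} (hy : F y = 0)
    (hb : BddBelow (connectedComponentIn {z | F z = 0} y)) {i j : ι} (hij : i ≠ j) {t : ℝ}
    (ht : y i ≤ t) :
    ∃ r ≤ y j, update (update y i t) j r ∈ connectedComponentIn {z | F z = 0} y := by
  have hmixed := hF.slopeAt_slopeAt_mul_pos hy hb hij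
  have hkeep (s : ℝ) (hs : y i ≤ s) : 0 < slopeAt F j y * slopeAt F j (update y i s) :=
    hF.slopeAt_mul_slopeAt_update_pos (right_ne_zero_of_mul hmixed.ne')
      (mul_nonneg (sub_nonneg.2 hs) hmixed.le)
  refine ⟨_, sub_le_self _ ?_, hF.hyperbola_mem_connectedComponentIn hy hij isPreconnected_Ici
    Set.self_mem_Ici ht fun s hs => right_ne_zero_of_mul (hkeep s hs).ne'⟩
  -- Both slopes have the sign of the mixed slope, so the arc of the hyperbola descends.
  have hmixed' := hF.slopeAt_slopeAt_mul_pos hy hb hij.symm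
  rw [slopeAt_slopeAt_comm, mul_comm] at hmixed'
  have hslopes : 0 < slopeAt F i y * slopeAt F j (update y i t) :=
    mul_pos_trans (mul_pos_trans hmixed' hmixed) (hkeep t ht)
  rw [mul_div_assoc]
  exact mul_nonneg (sub_nonneg.2 ht) (div_nonneg_iff.2 (mul_nonneg_iff.1 hslopes.le))

theorem exists_update_mem_of_le [Finite ι] (hF : IsMultiaffine F) {y z : ι → ℝ} (hy : F y = 0)
    (hb : BddBelow (connectedComponentIn {z | F z = 0} y)) (hyz : y ≤ z) (j : ι) :
    ∃ r ≤ y j, update z j r ∈ connectedComponentIn {z | F z = 0} y := by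
  cases nonempty_fintype ι
  have hpiecewise (T : Finset ι) :
      ∃ r ≤ y j, update (T.piecewise z y) j r ∈ connectedComponentIn {z | F z = 0} y := by
    induction T using Finset.induction_on with
    | empty => exact ⟨y j, le_rfl, by
        simpa using mem_connectedComponentIn (F := {z | F z = 0}) hy⟩
    | insert i T hi ih =>
      obtain ⟨r, hr, hmem⟩ := ih
      rw [piecewise_insert]
      obtain rfl | hij := eq_or_ne i j
      · exact ⟨r, hr, by rwa [update_idem]⟩
      · have hzero := connectedComponentIn_subset {z | F z = 0} y hmem
        rw [connectedComponentIn_eq hmem] at hb ⊢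
        obtain ⟨r', hr', hmem'⟩ := hF.exists_update_update_mem hzero hb hij (t := z i)
          (by simpa [hi, hij] using hyz i)
        rw [update_self] at hr'
        rw [update_comm hij.symm, update_idem] at hmem'
        exact ⟨r', hr'.trans hr, hmem'⟩
  simpa only [piecewise_univ] using hpiecewise univ

theorem slopeAt_nonneg_of_isUpperSet (hF : IsMultiaffine F) {Γ : Set (ι → ℝ)} (hΓ : IsUpperSet Γ)
    (hpos : ∀ z ∈ Γ, 0 < F z) {z : ι → ℝ} (hz : z ∈ Γ) (i : ι) : 0 ≤ slopeAt F i z := by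
  by_contra! hneg
  have hquot : F z / slopeAt F i z ≤ 0 := div_nonpos_of_nonneg_of_nonpos (hpos z hz).le hneg.le
  have hroot : F (update z i (z i - F z / slopeAt F i z)) = 0 := by
    rw [hF.update_eq, sub_sub_cancel_left, neg_mul, div_mul_cancel₀ _ hneg.ne, add_neg_cancel]
  exact (hpos _ (hΓ (le_update_self_iff.2 (le_sub_self_iff _ |>.2 hquot)) hz)).ne' hroot

theorem slopeAt_pos_of_bddBelow [Finite ι] (hF : IsMultiaffine F) (hcont : Continuous F)
    {Γ : Set (ι → ℝ)} (hΓ : IsUpperSet Γ) (hne : Γ.Nonempty) (hpos : ∀ z ∈ Γ, 0 < F z)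
    {y : ι → ℝ} (hy : F y = 0) (hb : BddBelow (connectedComponentIn {z | F z = 0} y)) (j : ι) :
    0 < slopeAt F j y := by
  obtain ⟨z, hz⟩ := hne
  obtain ⟨r, -, hr⟩ := hF.exists_update_mem_of_le hy hb (le_sup_right : y ≤ z ⊔ y) j
  have hnonneg : 0 ≤ slopeAt F j (update (z ⊔ y) j r) := by
    rw [slopeAt_update_self]
    exact hF.slopeAt_nonneg_of_isUpperSet hΓ hpos (hΓ le_sup_left hz) j
  by_contra! hle
  obtain ⟨w, hw, hslope⟩ := isPreconnected_connectedComponentIn.intermediate_value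
    (mem_connectedComponentIn (F := {z | F z = 0}) hy) hr
    (continuous_slopeAt hcont j).continuousOn ⟨hle, hnonneg⟩
  exact hF.slopeAt_ne_zero_of_bddBelow (connectedComponentIn_subset {z | F z = 0} y hw)
    (connectedComponentIn_eq hw ▸ hb) j hslope

theorem pos_of_forall_lt [Finite ι] [Nonempty ι] (hF : IsMultiaffine F) (hcont : Continuous F)
    {Γ : Set (ι → ℝ)} (hΓ : IsUpperSet Γ) (hne : Γ.Nonempty) (hpos : ∀ z ∈ Γ, 0 < F z)
    {y z : ι → ℝ} (hy : F y = 0) (hb : BddBelow (connectedComponentIn {z | F z = 0} y))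
    (hyz : ∀ i, y i < z i) : 0 < F z := by
  inhabit ι
  obtain ⟨r, hr, hmem⟩ := hF.exists_update_mem_of_le hy hb (fun i => (hyz i).le) default
  have hzero : F (update z default r) = 0 := connectedComponentIn_subset {z | F z = 0} y hmem
  have hslope := hF.slopeAt_pos_of_bddBelow hcont hΓ hne hpos hzero
    (connectedComponentIn_eq hmem ▸ hb) default
  have hvalue := hF.update_eq (update z default r) default (z default)
  rw [update_idem, update_eq_self, hzero, zero_add, update_self] at hvalue
  rw [hvalue]
  exact mul_pos (sub_pos.2 (hr.trans_lt (hyz default))) hslope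

end IsMultiaffine

end Multiaffine

/-! ### Components bounded below -/

section Components

open Set

variable {ι : Type*} [DecidableEq ι] [Fintype ι] [Nonempty ι] {c : ℝ} {a : Finset ι → ℝ}

namespace IsAdmissible

theorem connectedComponentIn_eq_positiveRegion (ha : IsAdmissible a) {x : ι → ℝ}
    (hx : x ∈ positiveRegion c a) :
    connectedComponentIn {y | 0 < penultimateComb c a y} x = positiveRegion c a :=
  connectedComponentIn_eq_inter isOpen_penultimateCone
    (convex_positiveRegion ha.nonneg).isPreconnected
    (inter_subset_left.trans ha.closure_positiveRegion_subset) hx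

theorem connectedComponentIn_eq_positiveRegion_of_bddBelow (ha : IsAdmissible a)
    (hne : (positiveRegion c a).Nonempty) {x : ι → ℝ} (hx : 0 < penultimateComb c a x)
    (hb : BddBelow (connectedComponentIn {y | 0 < penultimateComb c a y} x)) :
    connectedComponentIn {y | 0 < penultimateComb c a y} x = positiveRegion c a := by
  obtain ⟨z, hz⟩ := hne
  have hsup : z ⊔ x ∈ connectedComponentIn {y | 0 < penultimateComb c a y} x :=
    (isMultiaffine_penultimateComb c a).isUpperSet_positive_component hb le_sup_right
      (mem_connectedComponentIn hx)
  rw [connectedComponentIn_eq hsup]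
  exact ha.connectedComponentIn_eq_positiveRegion (ha.isUpperSet_positiveRegion le_sup_left hz)

theorem connectedComponentIn_eq_frontier (ha : IsAdmissible a) {x : ι → ℝ}
    (hx : x ∈ frontier (positiveRegion c a)) :
    connectedComponentIn {y | penultimateComb c a y = 0} x = frontier (positiveRegion c a) := by
  have hne : (positiveRegion c a).Nonempty := closure_nonempty_iff.1 ⟨x, hx.1⟩
  have hpre := isPreconnected_frontier_of_isUpperSet ha.isUpperSet_positiveRegion
    isOpen_positiveRegion hne (bddBelow_positiveRegion ha.nonneg)
  have hclosed : IsClosed (frontier (positiveRegion c a)) := isClosed_frontier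
  rw [ha.frontier_positiveRegion] at hx hpre hclosed ⊢
  refine connectedComponentIn_eq_inter isOpen_penultimateCone hpre ?_ hx
  exact fun y hy => (hclosed.closure_subset hy.1).1

theorem mem_frontier_positiveRegion_of_bddBelow (ha : IsAdmissible a)
    (hne : (positiveRegion c a).Nonempty) {x : ι → ℝ} (hx : penultimateComb c a x = 0)
    (hb : BddBelow (connectedComponentIn {y | penultimateComb c a y = 0} x)) :
    x ∈ frontier (positiveRegion c a) := by
  have hupper := ha.isUpperSet_positiveRegion (c := c)
  have hpos : univ.pi (fun i => Ioi (x i)) ⊆ {y | 0 < penultimateComb c a y} := fun z hz =>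
    (isMultiaffine_penultimateComb c a).pos_of_forall_lt continuous_penultimateComb
      hupper hne (fun w hw => hw.2) hx hb fun i => hz i (mem_univ i)
  have hpre : IsPreconnected (univ.pi fun i => Ioi (x i)) :=
    isPreconnected_univ_pi fun i => isPreconnected_Ioi
  obtain ⟨z, hz⟩ := hne
  have hsup : z ⊔ (x + 1) ∈ positiveRegion c a := hupper le_sup_left hz
  have horthant : univ.pi (fun i => Ioi (x i)) ⊆ positiveRegion c a := by
    rw [← ha.connectedComponentIn_eq_positiveRegion hsup]
    exact hpre.subset_connectedComponentIn
      (fun i _ => lt_sup_of_lt_right (lt_add_one (x i))) hpos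
  rw [isOpen_positiveRegion.frontier_eq]
  refine ⟨closure_mono horthant ?_, fun hmem => hmem.2.ne' hx⟩
  simp [closure_pi_set]

theorem nonempty_frontier_positiveRegion (ha : IsAdmissible a)
    (hne : (positiveRegion c a).Nonempty) : (frontier (positiveRegion c a)).Nonempty :=
  ⟨_, add_diagonalHeight_smul_mem_frontier ha.isUpperSet_positiveRegion isOpen_positiveRegion hne
    (bddBelow_positiveRegion ha.nonneg) 0⟩

end IsAdmissible

end Components

/-! ### The polynomials of the theorem -/

section Permutations

open Finset

variable {ι : Type*} [DecidableEq ι]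

theorem penultimate_comp_perm (s : Equiv.Perm ι) (T : Finset ι) (x : ι → ℝ) :
    penultimate T (x ∘ s) = penultimate (T.map s.toEmbedding) x := by
  simp only [penultimate, sum_map]
  refine sum_congr rfl fun i _ => ?_
  rw [← map_erase, prod_map]
  rfl

theorem comp_perm_mem_penultimateCone (s : Equiv.Perm ι) {x : ι → ℝ}
    (hx : x ∈ penultimateCone ι) : x ∘ s ∈ penultimateCone ι := fun T hT => by
  rw [penultimate_comp_perm]
  exact hx _ hT.map

variable [Fintype ι]

theorem penultimateComb_comp_perm {c : ℝ} {a : Finset ι → ℝ} (s : Equiv.Perm ι)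
    (ha : ∀ U, a (U.map s.toEmbedding) = a U) (x : ι → ℝ) :
    penultimateComb c a (x ∘ s) = penultimateComb c a x := by
  have hsum : ∑ U, a U * penultimate (U.map s.toEmbedding) x = ∑ U, a U * penultimate U x :=
    Fintype.sum_equiv s.finsetCongr _ _ fun U => by rw [Equiv.finsetCongr_apply, ha]
  simp only [penultimateComb, penultimate_comp_perm, map_univ_equiv, hsum, Function.comp_apply,
    Equiv.prod_comp s x]

end Permutations

section GuanZhang

open Finset

variable {ι : Type*} [Fintype ι] {c : ℕ → ℝ}

/-- The coefficient of `penultimate U` in an expansion of `∑ k ∈ range (n - 1), c k * σ k`, where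
`n` is the number of variables: the polynomials `penultimate U` with `#U = k + 1` add up to
`(n - k) * σ k`. -/
noncomputable def guanZhangWeight (c : ℕ → ℝ) (U : Finset ι) : ℝ :=
  ∑ k ∈ range (Fintype.card ι - 1), if #U = k + 1 then c k / (Fintype.card ι - k) else 0

theorem guanZhangWeight_map (s : Equiv.Perm ι) (U : Finset ι) :
    guanZhangWeight c (U.map s.toEmbedding) = guanZhangWeight c U := by
  simp only [guanZhangWeight, card_map]

theorem card_sub_pos_of_mem_range {k : ℕ} (hk : k ∈ range (Fintype.card ι - 1)) :
    (0 : ℝ) < Fintype.card ι - k := by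
  rw [sub_pos, Nat.cast_lt]
  exact (mem_range.1 hk).trans_le (Nat.sub_le _ _)

theorem isAdmissible_guanZhangWeight (hc : ∀ k ∈ range (Fintype.card ι - 1), 0 ≤ c k)
    (hsum : 0 < ∑ k ∈ range (Fintype.card ι - 1), c k) :
    IsAdmissible (guanZhangWeight c : Finset ι → ℝ) := by
  classical
  have hterm (U : Finset ι) : ∀ k ∈ range (Fintype.card ι - 1),
      0 ≤ if #U = k + 1 then c k / (Fintype.card ι - k) else 0 := fun k hk => by
    have := div_nonneg (hc k hk) (card_sub_pos_of_mem_range hk).le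
    split_ifs <;> positivity
  refine ⟨fun U => sum_nonneg (hterm U), fun i => ?_⟩
  obtain ⟨k, hk, hpos⟩ := exists_lt_of_sum_lt (f := fun _ => (0 : ℝ)) (by simpa using hsum)
  obtain ⟨U, hU, hcard⟩ := exists_subset_card_eq (s := univ.erase i) (n := k + 1) (by
    rw [card_erase_of_mem (mem_univ i), card_univ]
    exact mem_range.1 hk)
  refine ⟨U, card_pos.1 (hcard ▸ k.succ_pos), fun hi => notMem_erase i univ (hU hi),
    sum_pos' (hterm U) ⟨k, hk, ?_⟩⟩
  rw [if_pos hcard]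
  exact div_pos hpos (card_sub_pos_of_mem_range hk)

variable [DecidableEq ι]

theorem sum_penultimate_powersetCard {k : ℕ} (hk : k ≤ Fintype.card ι) (x : ι → ℝ) :
    ∑ U ∈ powersetCard (k + 1) univ, penultimate U x =
      (Fintype.card ι - k : ℝ) * ∑ V ∈ powersetCard k univ, ∏ i ∈ V, x i := by
  calc ∑ U ∈ powersetCard (k + 1) univ, penultimate U x
      = ∑ V ∈ powersetCard k univ, ∑ _i ∈ Vᶜ, ∏ j ∈ V, x j := by
        simp only [penultimate]
        rw [sum_sigma', sum_sigma']
        refine sum_bij' (fun p _ => ⟨p.1.erase p.2, p.2⟩) (fun p _ => ⟨insert p.2 p.1, p.2⟩)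
          ?_ ?_ ?_ ?_ fun _ _ => rfl <;> simp +contextual
    _ = _ := by
        rw [mul_sum]
        refine sum_congr rfl fun V hV => ?_
        rw [sum_const, card_compl, (mem_powersetCard.1 hV).2, nsmul_eq_mul, Nat.cast_sub hk]

theorem penultimate_univ_eq_sum [Nonempty ι] (x : ι → ℝ) :
    penultimate univ x = ∑ V ∈ powersetCard (Fintype.card ι - 1) univ, ∏ i ∈ V, x i := by
  have h := sum_penultimate_powersetCard (Nat.sub_le (Fintype.card ι) 1) x
  rw [Nat.sub_add_cancel Fintype.card_pos, ← card_univ, powersetCard_self, sum_singleton,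
    card_univ, Nat.cast_pred Fintype.card_pos, sub_sub_cancel, one_mul] at h
  exact h

theorem sum_guanZhangWeight_mul_penultimate (c : ℕ → ℝ) (x : ι → ℝ) :
    ∑ U, guanZhangWeight c U * penultimate U x =
      ∑ k ∈ range (Fintype.card ι - 1), c k * ∑ V ∈ powersetCard k univ, ∏ i ∈ V, x i := by
  simp only [guanZhangWeight, sum_mul, ite_mul, zero_mul]
  rw [sum_comm]
  refine sum_congr rfl fun k hk => ?_
  have hpos := card_sub_pos_of_mem_range hk
  have hle : k ≤ Fintype.card ι := (mem_range.1 hk).le.trans (Nat.sub_le _ _)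
  rw [← sum_filter, ← mul_sum, univ_filter_card_eq, sum_penultimate_powersetCard hle,
    ← mul_assoc, div_mul_cancel₀ _ hpos.ne']

variable {n : ℕ} [NeZero n]

theorem eval_guanZhangPoly (c : ℕ → ℝ) (x : Fin n → ℝ) :
    MvPolynomial.eval x (guanZhangPoly n c) =
      penultimateComb (c (n - 1)) (guanZhangWeight c) x := by
  simp only [guanZhangPoly, penultimateComb, MvPolynomial.esymm, map_add, map_sub, map_mul,
    map_prod, map_sum, MvPolynomial.eval_X, MvPolynomial.eval_C, penultimate_univ_eq_sum,
    sum_guanZhangWeight_mul_penultimate, Fintype.card_fin]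

theorem positiveSet_guanZhangPoly (c : ℕ → ℝ) : positiveSet (guanZhangPoly n c) =
    {x | 0 < penultimateComb (c (n - 1)) (guanZhangWeight c) x} := by
  simp only [positiveSet, eval_guanZhangPoly]

theorem zeroSet_guanZhangPoly (c : ℕ → ℝ) : zeroSet (guanZhangPoly n c) =
    {x | penultimateComb (c (n - 1)) (guanZhangWeight c) x = 0} := by
  simp only [zeroSet, eval_guanZhangPoly]

theorem nonempty_positiveRegion_guanZhangWeight (hc : ∀ k ∈ range (n - 1), 0 ≤ c k)
    (hsum : 0 < ∑ k ∈ range (n - 1), c k) :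
    (positiveRegion (c (n - 1)) (guanZhangWeight c : Finset (Fin n) → ℝ)).Nonempty := by
  have hn : n ≠ 0 := NeZero.ne n
  obtain ⟨x, -, hx, hpos⟩ :=
    (hasNonposLowerCoeffs_diagonalRestriction_guanZhangPoly hn hc).exists_isGreatest_root_pos
      (by rwa [natDegree_diagonalRestriction_guanZhangPoly hn])
      (trailingCoeff_diagonalRestriction_guanZhangPoly_neg hc hsum)
  refine ⟨fun _ => x + 1, mem_penultimateCone_of_pos fun _ => by linarith, ?_⟩
  rw [← eval_guanZhangPoly, ← eval_diagonalRestriction]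
  exact hpos _ (lt_add_one x)

end GuanZhang

section OrthantTranslates

variable {n : ℕ}

theorem inOrthantTranslate_iff_bddBelow {C : Set (Fin n → ℝ)} :
    InOrthantTranslate C ↔ BddBelow C := by
  constructor
  · rintro ⟨q, hq⟩
    exact ⟨q, fun x hx i => (hq x hx i).le⟩
  · rintro ⟨q, hq⟩
    exact ⟨fun i => q i - 1, fun x hx i => (sub_one_lt _).trans_le (hq hx i)⟩

theorem isComponentOf_and_inOrthantTranslate_iff {S A : Set (Fin n → ℝ)} {x : Fin n → ℝ}
    (hx : x ∈ A) (hA : connectedComponentIn S x = A) (hb : BddBelow A)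
    (hunique : ∀ y ∈ S, BddBelow (connectedComponentIn S y) → connectedComponentIn S y = A)
    {C : Set (Fin n → ℝ)} : IsComponentOf C S ∧ InOrthantTranslate C ↔ C = A := by
  rw [inOrthantTranslate_iff_bddBelow]
  constructor
  · rintro ⟨⟨y, hy, rfl⟩, hbelow⟩
    exact hunique y hy hbelow
  · rintro rfl
    exact ⟨⟨x, connectedComponentIn_subset S x (hA ▸ hx), hA.symm⟩, hb⟩

variable [NeZero n] {c : ℝ} {a : Finset (Fin n) → ℝ}

namespace IsAdmissible

theorem isComponentOf_positive_iff (ha : IsAdmissible a) (hne : (positiveRegion c a).Nonempty)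
    {C : Set (Fin n → ℝ)} :
    IsComponentOf C {x | 0 < penultimateComb c a x} ∧ InOrthantTranslate C ↔
      C = positiveRegion c a :=
  isComponentOf_and_inOrthantTranslate_iff hne.some_mem
    (ha.connectedComponentIn_eq_positiveRegion hne.some_mem) (bddBelow_positiveRegion ha.nonneg)
    fun _ hy hb => ha.connectedComponentIn_eq_positiveRegion_of_bddBelow hne hy hb

theorem isComponentOf_zero_iff (ha : IsAdmissible a) (hne : (positiveRegion c a).Nonempty)
    {C : Set (Fin n → ℝ)} :
    IsComponentOf C {x | penultimateComb c a x = 0} ∧ InOrthantTranslate C ↔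
      C = frontier (positiveRegion c a) := by
  obtain ⟨x, hx⟩ := ha.nonempty_frontier_positiveRegion hne
  exact isComponentOf_and_inOrthantTranslate_iff hx (ha.connectedComponentIn_eq_frontier hx)
    (bddBelow_frontier_positiveRegion ha.nonneg) fun y hy hb =>
      ha.connectedComponentIn_eq_frontier (ha.mem_frontier_positiveRegion_of_bddBelow hne hy hb)

theorem frontier_positiveRegion_subset_upsilonOne (ha : IsAdmissible a)
    (hperm : ∀ (s : Equiv.Perm (Fin n)) (U : Finset (Fin n)), a (U.map s.toEmbedding) = a U) :
    frontier (positiveRegion c a) ⊆ upsilonOne (positiveRegion c a) := by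
  intro μ hμ s
  rw [ha.frontier_positiveRegion] at hμ
  obtain ⟨hcone, hzero⟩ := hμ
  refine ⟨Function.update (μ ∘ s) (Fin.rev 0) (μ (s (Fin.rev 0)) + 1), ?_, fun i hi => ?_⟩
  · exact ha.mem_positiveRegion_of_lt (comp_perm_mem_penultimateCone s hcone)
      (penultimateComb_comp_perm s (hperm s) μ ▸ hzero.ge) (lt_update_self_iff.2 (lt_add_one _))
  · have hlast : i ≠ Fin.rev 0 := by
      rintro rfl
      rw [Fin.val_rev, Fin.val_zero] at hi
      lia
    rw [Function.update_of_ne hlast, Function.comp_apply]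

end IsAdmissible

end OrthantTranslates

theorem mainTheorem8 (n : ℕ) (c : ℕ → ℝ)
    (hc : ∀ k ∈ Finset.range (n - 1), 0 ≤ c k)
    (hsum : 0 < ∑ k ∈ Finset.range (n - 1), c k) :
    -- the diagonal restriction
    IsStrictlyRightNoetherian (diagonalRestriction (guanZhangPoly n c)) ∧
    (∃ x₀, IsGreatest {x | (diagonalRestriction (guanZhangPoly n c)).IsRoot x} x₀ ∧ 0 < x₀) ∧
    -- the level set is the boundary of a convex region
    ∃ Γ : Set (Fin n → ℝ),
      IsStrictlyUpsilonStable (guanZhangPoly n c) Γ ∧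
      (∀ Γ', IsUpsilonStable (guanZhangPoly n c) Γ' → Γ' = Γ) ∧
      (∀ L, (IsComponentOf L (zeroSet (guanZhangPoly n c)) ∧ InOrthantTranslate L) ↔
        L = frontier Γ) ∧
      Convex ℝ Γ := by
  have hn : n ≠ 0 := by
    rintro rfl
    simp at hsum
  have : NeZero n := ⟨hn⟩
  have hlower := hasNonposLowerCoeffs_diagonalRestriction_guanZhangPoly hn hc
  have hdeg := (natDegree_diagonalRestriction_guanZhangPoly hn c).trans_ne hn
  have hneg := trailingCoeff_diagonalRestriction_guanZhangPoly_neg hc hsum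
  have ha : IsAdmissible (guanZhangWeight c : Finset (Fin n) → ℝ) :=
    isAdmissible_guanZhangWeight (by rwa [Fintype.card_fin]) (by rwa [Fintype.card_fin])
  have hne := nonempty_positiveRegion_guanZhangWeight hc hsum
  have hstable (Γ : Set (Fin n → ℝ)) : IsUpsilonStable (guanZhangPoly n c) Γ ↔
      Γ = positiveRegion (c (n - 1)) (guanZhangWeight c) := by
    rw [IsUpsilonStable, positiveSet_guanZhangPoly, ha.isComponentOf_positive_iff hne]
  obtain ⟨x₀, hgreatest, hpos, -⟩ := hlower.exists_isGreatest_root_pos hdeg hneg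
  refine ⟨hlower.isStrictlyRightNoetherian hdeg hneg, ⟨x₀, hgreatest, hpos⟩,
    positiveRegion (c (n - 1)) (guanZhangWeight c),
    ⟨(hstable _).2 rfl, ha.frontier_positiveRegion_subset_upsilonOne guanZhangWeight_map⟩,
    fun Γ' => (hstable Γ').1, fun L => ?_, convex_positiveRegion ha.nonneg⟩
  rw [zeroSet_guanZhangPoly, ha.isComponentOf_zero_iff hne]
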